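/- Let $\mathfrak g$ be a finite-dimensional real semisimple Lie algebra with Killing form $\langle\,,\rangle$, let $G$ be a (smooth) Lie group with Lie algebra $\mathfrak g$, and let $\mathfrak g=\mathfrak g_0\oplus\mathfrak g_1$ be a Cartan decomposition, that is, $[\mathfrak g_0,\mathfrak g_0]\subset\mathfrak g_0$, $[\mathfrak g_0,\mathfrak g_1]\subset\mathfrak g_1$, $[\mathfrak g_1,\mathfrak g_1]\subset\mathfrak g_0$ (no sign of the Killing form is required on the summands). Let $\mathfrak a$ be a maximal abelian subspace of $\mathfrak g_1$, $k=\dim\mathfrak a$, and put $\mathfrak m=\mathfrak a^\perp\cap\mathfrak g_1$, $(\mathfrak g_0)_{\mathfrak a}=\{X\in\mathfrak g_0:[X,\mathfrak a]=0\}$, $\mathfrak b=\mathfrak g_0\cap(\mathfrak g_0)_{\mathfrak a}^\perp$, orthogonality being with respect to the Killing form. The Cartan tableau is $\mathfrak m$, regarded in $\mathrm{Hom}(\mathfrak a,\mathfrak b)$ through $X\mapsto Q_X:=-\mathrm{ad}_X|_{\mathfrak a}$ (an injective map if $\mathfrak a\cap\mathfrak a^\perp=0$). *The Pfaffian system.*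 Let $(A_1,\dots,A_k,B_1,\dots,B_h,C_1,\dots,C_s)$ be any basis of $\mathfrak g$ such that the $A_i$ span $\mathfrak a$ and the $B_j$ span $\sum_{X\in\mathfrak m}\mathrm{Im}\,Q_X$, and let $(\alpha^i,\beta^j,\gamma^l)$ be the dual left-invariant coframe on $G$. The Pfaffian system associated with the Cartan tableau is the system on $Y=G\times\mathfrak m$ generated by the 1-forms $\eta^j=\beta^j-\sum_i Q^j_i(p)\,\alpha^i$ $(1\le j\le h)$ and $\gamma^1,\dots,\gamma^s$ at the points $(g,p)$, where $Q_p(A_i)=\sum_j Q^j_i(p)B_j$, with independence condition $\alpha^1\wedge\dots\wedge\alpha^k\neq0$. An integral manifold is a smooth immersion $\Phi:N\to Y$ of a smooth $k$-dimensional manifold $N$ such that $\Phi^*\eta^j=0$, $\Phi^*\gamma^l=0$ and $\Phi^*(\alpha^1\wedge\dots\wedge\alpha^k)$ vanishes nowhere. *The $G/G_0$-system.* Let $(E_1,\dots,E_k)$ be a basis of $\mathfrak a$ with linear coordinates $x^1,\dots,x^k$, and $U\subset\mathfrak a$ open. A smooth map $F:U\to\mathfrak m$ is a solution of the $G/G_0$-system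 if $$\Big[E_i,\frac{\partial F}{\partial x^j}\Big]-\Big[E_j,\frac{\partial F}{\partial x^i}\Big]=\big[[E_i,F],[E_j,F]\big]\qquad(1\le i<j\le k)$$ on $U$. A smooth map $g:U\to G$ is a primitive of $\theta=\alpha+[\alpha,F]$ if $g^{-1}dg=\alpha+[\alpha,F]$ on $U$, where $\alpha$ is the tautological $\mathfrak a$-valued 1-form $\alpha_x(v)=v$. *Statement.* 1. If $U\subset\mathfrak a$ is open (for instance $U=\mathfrak a$), $F:U\to\mathfrak m$ is a solution of the $G/G_0$-system and $g:U\to G$ satisfies $g^{-1}dg=\alpha+[\alpha,F]$, then $U\ni x\mapsto(g(x),F(x))\in G\times\mathfrak m$ is an integral manifold of the Pfaffian system associated with the Cartan tableau $\mathfrak m$. 2. Conversely, every integral manifold arises locally in this way: if $\Phi:N\to G\times\mathfrak m$ is an integral manifold and $q\in N$, then there are an open set $U\subset\mathfrak a$, a diffeomorphism $\varphi$ of $U$ onto an open neighbourhood of $q$ in $N$, a solution $F:U\to\mathfrak m$ of the $G/G_0$-system and a smooth $g:U\to G$ with $g^{-1}dg=\alpha+[\alpha,F]$ such that $\Phi(\varphi(x))=(g(x),F(x))$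 for all $x\in U$. 3. If $U\subset\mathfrak a$ is open, $g:U\to G$ and $F:U\to\mathfrak m$ are maps such that $\Phi:U\ni x\mapsto(g(x),F(x))$ is an integral manifold, and $\Phi^*\alpha^i$ is the restriction to $U$ of the constant 1-form dual to $A_i$ for $1\le i\le k$ (that is, $\sum_i\Phi^*\alpha^i\otimes A_i$ is the tautological form of $U$), then on all of $U$ the map $F$ is a solution of the $G/G_0$-system and $g^{-1}dg=\alpha+[\alpha,F]$. -/

import Mathlib

open scoped Manifold ContDiff

/-! ### Lie algebras carrying a norm -/

/-- A Lie ring whose additive group carries a norm. No compatibility between norm and bracket is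
asked for: on a finite-dimensional Lie algebra the norm only serves to speak of open sets and
smooth maps, and all norms give the same ones. -/
class NormedLieRing (L : Type*) extends NormedAddCommGroup L, LieRing L

/-- A real Lie algebra whose underlying vector space is normed. -/
class NormedLieAlgebra (L : Type*) [NormedLieRing L] extends NormedSpace ℝ L, LieAlgebra ℝ L

/-! ### Symmetric decompositions and the Cartan tableau -/

section Algebra

variable {𝔤 : Type*} [LieRing 𝔤] [LieAlgebra ℝ 𝔤]

/-- `𝔤 = 𝔤₀ ⊕ 𝔤₁` with `[𝔤₀, 𝔤₀] ⊆ 𝔤₀`, `[𝔤₀, 𝔤₁] ⊆ 𝔤₁` and `[𝔤₁, 𝔤₁] ⊆ 𝔤₀`: the Cartan decomposition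
of the Lie algebra of a symmetric space. No sign of the Killing form on the summands is imposed,
so that compact, noncompact and pseudo-Riemannian types are all included. -/
structure IsCartanDecomposition (𝔤₀ 𝔤₁ : Submodule ℝ 𝔤) : Prop where
  isCompl : IsCompl 𝔤₀ 𝔤₁
  lie_zero_zero : ∀ X ∈ 𝔤₀, ∀ Y ∈ 𝔤₀, ⁅X, Y⁆ ∈ 𝔤₀
  lie_zero_one : ∀ X ∈ 𝔤₀, ∀ Y ∈ 𝔤₁, ⁅X, Y⁆ ∈ 𝔤₁
  lie_one_one : ∀ X ∈ 𝔤₁, ∀ Y ∈ 𝔤₁, ⁅X, Y⁆ ∈ 𝔤₀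

/-- `𝔞` is a maximal abelian subspace of `𝔤₁`. -/
def IsMaximalAbelianIn (𝔤₁ 𝔞 : Submodule ℝ 𝔤) : Prop :=
  Maximal (fun W : Submodule ℝ 𝔤 => W ≤ 𝔤₁ ∧ ∀ X ∈ W, ∀ Y ∈ W, ⁅X, Y⁆ = 0) 𝔞

/-- The orthogonal of a subspace with respect to the Killing form. -/
noncomputable def killingPerp (W : Submodule ℝ 𝔤) : Submodule ℝ 𝔤 where
  carrier := {X | ∀ Y ∈ W, killingForm ℝ 𝔤 X Y = 0}
  add_mem' := fun hX hX' Y hY => by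
    rw [map_add, LinearMap.add_apply, hX Y hY, hX' Y hY, add_zero]
  zero_mem' := fun Y _ => by rw [map_zero, LinearMap.zero_apply]
  smul_mem' := fun c X hX Y hY => by
    rw [map_smul, LinearMap.smul_apply, hX Y hY, smul_zero]

/-- `𝔪 = 𝔞^⊥ ∩ 𝔤₁`. -/
noncomputable def cartanM (𝔤₁ 𝔞 : Submodule ℝ 𝔤) : Submodule ℝ 𝔤 := killingPerp 𝔞 ⊓ 𝔤₁

/-- `(𝔤₀)_𝔞 = {X ∈ 𝔤₀ : [X, 𝔞] = 0}`. -/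
def centralizerIn (𝔤₀ 𝔞 : Submodule ℝ 𝔤) : Submodule ℝ 𝔤 where
  carrier := {X | X ∈ 𝔤₀ ∧ ∀ A ∈ 𝔞, ⁅X, A⁆ = 0}
  add_mem' := fun hX hY =>
    ⟨𝔤₀.add_mem hX.1 hY.1, fun A hA => by rw [add_lie, hX.2 A hA, hY.2 A hA, add_zero]⟩
  zero_mem' := ⟨𝔤₀.zero_mem, fun A _ => zero_lie A⟩
  smul_mem' := fun c X hX =>
    ⟨𝔤₀.smul_mem c hX.1, fun A hA => by rw [smul_lie, hX.2 A hA, smul_zero]⟩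

/-- `𝔟 = 𝔤₀ ∩ ((𝔤₀)_𝔞)^⊥`. -/
noncomputable def cartanB (𝔤₀ 𝔞 : Submodule ℝ 𝔤) : Submodule ℝ 𝔤 :=
  𝔤₀ ⊓ killingPerp (centralizerIn 𝔤₀ 𝔞)

theorem neg_lie_mem_cartanB {𝔤₀ 𝔤₁ 𝔞 : Submodule ℝ 𝔤} (hd : IsCartanDecomposition 𝔤₀ 𝔤₁)
    (ha : IsMaximalAbelianIn 𝔤₁ 𝔞) {X A : 𝔤} (hX : X ∈ cartanM 𝔤₁ 𝔞) (hA : A ∈ 𝔞) :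
    -⁅X, A⁆ ∈ cartanB 𝔤₀ 𝔞 := by
  refine neg_mem ⟨hd.lie_one_one X hX.2 A (ha.prop.1 hA), fun Y hY => ?_⟩
  rw [LieModule.traceForm_apply_lie_apply, ← lie_skew, hY.2 A hA, neg_zero, map_zero]

/-- The Cartan tableau: `X ∈ 𝔪` is regarded as the element `-ad_X` of `Hom(𝔞, 𝔟)`. -/
noncomputable def cartanTableau {𝔤₀ 𝔤₁ 𝔞 : Submodule ℝ 𝔤} (hd : IsCartanDecomposition 𝔤₀ 𝔤₁)
    (ha : IsMaximalAbelianIn 𝔤₁ 𝔞) : cartanM 𝔤₁ 𝔞 →ₗ[ℝ] 𝔞 →ₗ[ℝ] cartanB 𝔤₀ 𝔞 :=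
  LinearMap.mk₂ ℝ (fun X A => ⟨-⁅(X : 𝔤), (A : 𝔤)⁆, neg_lie_mem_cartanB hd ha X.2 A.2⟩)
    (fun X X' A => Subtype.ext (by simp [add_comm]))
    (fun c X A => Subtype.ext (by simp [-lie_skew, smul_neg]))
    (fun X A A' => Subtype.ext (by simp [add_comm]))
    (fun c X A => Subtype.ext (by simp [-lie_skew, smul_neg]))

/-- A basis `(A_1, …, A_k, B_1, …, B_h, C_1, …, C_s)` of `𝔤` adapted to a tableau in `Hom(𝔞, 𝔟)`, the
tableau being given by a linear parametrization `Q : P → Hom(𝔞, 𝔟)`: the `A_i` span `𝔞`, and the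
`B_j` span the sum of the images of the members of the tableau. The `C`'s are arbitrary. -/
structure AdaptedBasis {P : Type*} [AddCommGroup P] [Module ℝ P] {𝔞 𝔟 : Submodule ℝ 𝔤}
    (Q : P →ₗ[ℝ] 𝔞 →ₗ[ℝ] 𝔟) (k h s : ℕ) where
  basis : Module.Basis (Fin k ⊕ Fin h ⊕ Fin s) ℝ 𝔤
  span_A : Submodule.span ℝ (Set.range fun i => basis (Sum.inl i)) = 𝔞
  span_B : Submodule.span ℝ (Set.range fun j => basis (Sum.inr (Sum.inl j))) =
    ⨆ p : P, LinearMap.range (𝔟.subtype ∘ₗ Q p)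

end Algebra

/-! ### Pfaffian systems and integral manifolds -/

section Pfaffian

variable {E₁ : Type*} [NormedAddCommGroup E₁] [NormedSpace ℝ E₁] {H₁ : Type*} [TopologicalSpace H₁]
  (I₁ : ModelWithCorners ℝ E₁ H₁) (M₁ : Type*) [TopologicalSpace M₁] [ChartedSpace H₁ M₁]
  {E₂ : Type*} [NormedAddCommGroup E₂] [NormedSpace ℝ E₂] {H₂ : Type*} [TopologicalSpace H₂]
  (I₂ : ModelWithCorners ℝ E₂ H₂) {M₂ : Type*} [TopologicalSpace M₂] [ChartedSpace H₂ M₂]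

/-- Differential 1-forms, as fields of linear forms on the tangent spaces. -/
abbrev OneForm : Type _ := ∀ y : M₁, TangentSpace I₁ y →ₗ[ℝ] ℝ

variable {M₁}

/-- The pullback `f^* θ`. -/
noncomputable def OneForm.pullback (f : M₁ → M₂) (θ : OneForm I₂ M₂) : OneForm I₁ M₁ :=
  fun x => θ (f x) ∘ₗ (mfderiv I₁ I₂ f x).toLinearMap

variable (M₁)

/-- A Pfaffian system: a set of 1-forms generating a differential ideal, and the factors
`ω^1, …, ω^k` of the independence condition `ω^1 ∧ ⋯ ∧ ω^k ≠ 0`. -/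
structure PfaffianSystem (k : ℕ) where
  gens : Set (OneForm I₁ M₁)
  indep : Fin k → OneForm I₁ M₁

variable {M₁ I₁}

/-- `Φ : N → M` is an integral manifold of the Pfaffian system `S`: `N` has dimension `k`, `Φ` is a
smooth immersion, the generators pull back to `0`, and `ω^1 ∧ ⋯ ∧ ω^k` pulls back to a `k`-form
that vanishes nowhere. (Its value on `(v_1, …, v_k)` is the determinant below.) -/
structure IsIntegralManifold {k : ℕ} (S : PfaffianSystem I₁ M₁ k) (Φ : M₂ → M₁) : Prop where
  finrank_eq : Module.finrank ℝ E₂ = k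
  contMDiff : ContMDiff I₂ I₁ ∞ Φ
  immersion : ∀ q, Function.Injective (mfderiv I₂ I₁ Φ q)
  pullback_eq_zero : ∀ θ ∈ S.gens, ∀ q, OneForm.pullback I₂ I₁ Φ θ q = 0
  indep_ne_zero : ∀ q, ∃ v : Fin k → TangentSpace I₂ q,
    (Matrix.of fun i j => OneForm.pullback I₂ I₁ Φ (S.indep i) q (v j)).det ≠ 0

end Pfaffian

/-! ### The Pfaffian system associated with a tableau -/

section LieGroups

/-- A smooth Lie group has the regularity under which its Lie algebra is defined. -/
instance LieGroup.minSmoothness_three_of_smooth {E : Type*} [NormedAddCommGroup E]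
    [NormedSpace ℝ E] {G : Type*} [TopologicalSpace G] [ChartedSpace E G] [Group G]
    [LieGroup 𝓘(ℝ, E) ∞ G] : LieGroup 𝓘(ℝ, E) (minSmoothness ℝ 3) G :=
  LieGroup.of_le (n := ∞) (by
    rw [minSmoothness_of_isRCLikeNormedField]
    exact WithTop.coe_le_coe.2 (le_top : (3 : ℕ∞) ≤ ⊤))

variable {E : Type*} [NormedAddCommGroup E] [NormedSpace ℝ E] [CompleteSpace E]
  {G : Type*} [TopologicalSpace G] [ChartedSpace E G] [Group G] [LieGroup 𝓘(ℝ, E) ∞ G]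
  {𝔤 : Type*} [NormedLieRing 𝔤] [NormedLieAlgebra 𝔤]

/-- The left-invariant Maurer--Cartan form `g⁻¹ dg` of a Lie group `G`, with values in the Lie
algebra `𝔤` of `G`: a tangent vector at `g` is carried to the identity by left translation. -/
noncomputable def maurerCartan (ι : 𝔤 ≃ₗ⁅ℝ⁆ GroupLieAlgebra 𝓘(ℝ, E) G) (g : G) :
    TangentSpace 𝓘(ℝ, E) g →ₗ[ℝ] 𝔤 where
  toFun v := ι.symm
    (mfderiv 𝓘(ℝ, E) 𝓘(ℝ, E) (fun b : G => g⁻¹ * b) g v : TangentSpace 𝓘(ℝ, E) (1 : G))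
  map_add' v w := by
    rw [map_add]
    exact map_add ι.symm _ _
  map_smul' c v := by
    rw [map_smul]
    exact map_smul ι.symm c _

variable {P : Type*} [NormedAddCommGroup P] [NormedSpace ℝ P] {𝔞 𝔟 : Submodule ℝ 𝔤}
  {Q : P →ₗ[ℝ] 𝔞 →ₗ[ℝ] 𝔟} {k h s : ℕ}

/-- The members of the left-invariant coframe on `G` dual to a basis of `𝔤`, pulled back to
`Y = G × P`. -/
noncomputable def coframeForm {n : Type*} (P : Type*) [NormedAddCommGroup P] [NormedSpace ℝ P]
    (ι : 𝔤 ≃ₗ⁅ℝ⁆ GroupLieAlgebra 𝓘(ℝ, E) G) (b : Module.Basis n ℝ 𝔤) (i : n) :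
    OneForm (𝓘(ℝ, E).prod 𝓘(ℝ, P)) (G × P) :=
  OneForm.pullback (𝓘(ℝ, E).prod 𝓘(ℝ, P)) 𝓘(ℝ, E) (Prod.fst : G × P → G)
    (fun g => b.coord i ∘ₗ maurerCartan ι g)

/-- The Pfaffian system on `Y = G × P` associated with the tableau parametrized by
`Q : P → Hom(𝔞, 𝔟)`: it is generated by the forms `η^j = β^j - Q^j_i(p) α^i` and `γ^1, …, γ^s`, where
`Q(p) = Q^j_i(p) B_j ⊗ α^i`, with independence condition `α^1 ∧ ⋯ ∧ α^k ≠ 0`. -/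
noncomputable def associatedSystem (ι : 𝔤 ≃ₗ⁅ℝ⁆ GroupLieAlgebra 𝓘(ℝ, E) G)
    (e : AdaptedBasis Q k h s) : PfaffianSystem (𝓘(ℝ, E).prod 𝓘(ℝ, P)) (G × P) k where
  gens :=
    (Set.range fun j : Fin h => fun y : G × P =>
      coframeForm P ι e.basis (Sum.inr (Sum.inl j)) y -
        ∑ i : Fin k,
          e.basis.coord (Sum.inr (Sum.inl j))
              (Q y.2 ⟨e.basis (Sum.inl i), e.span_A.le (Submodule.subset_span ⟨i, rfl⟩)⟩ : 𝔤) •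
            coframeForm P ι e.basis (Sum.inl i) y) ∪
    Set.range fun l : Fin s => coframeForm P ι e.basis (Sum.inr (Sum.inr l))
  indep := fun i => coframeForm P ι e.basis (Sum.inl i)

/-! ### The `G/G₀`-system and primitives -/

/-- `F : U → 𝔪` is a (smooth) solution on the open set `U ⊆ 𝔞` of the `G/G₀`-system
`[A_i, ∂F/∂x^j] - [A_j, ∂F/∂x^i] = [[A_i, F], [A_j, F]]`, `i < j`, where the `x^i` are the linear
coordinates on `𝔞` with respect to the basis `(A_1, …, A_k)`. -/
def IsSystemSolution {𝔪 : Submodule ℝ 𝔤} (A : Module.Basis (Fin k) ℝ 𝔞) (U : Set 𝔞)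
    (F : 𝔞 → 𝔪) : Prop :=
  ContDiffOn ℝ ∞ F U ∧ ∀ x ∈ U, ∀ i j : Fin k, i < j →
    ⁅(A i : 𝔤), (fderiv ℝ F x (A j) : 𝔤)⁆ - ⁅(A j : 𝔤), (fderiv ℝ F x (A i) : 𝔤)⁆ =
      ⁅⁅(A i : 𝔤), (F x : 𝔤)⁆, ⁅(A j : 𝔤), (F x : 𝔤)⁆⁆

/-- `g : U → G` is a (smooth) primitive of `θ = α + [α, F]`, that is `g⁻¹ dg = α + [α, F]` on `U`, where
`α` is the tautological `𝔞`-valued 1-form, `α_x(v) = v`. -/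
def IsPrimitive {𝔪 : Submodule ℝ 𝔤} (ι : 𝔤 ≃ₗ⁅ℝ⁆ GroupLieAlgebra 𝓘(ℝ, E) G) (U : Set 𝔞)
    (F : 𝔞 → 𝔪) (g : 𝔞 → G) : Prop :=
  ContMDiffOn 𝓘(ℝ, 𝔞) 𝓘(ℝ, E) ∞ g U ∧ ∀ x ∈ U, ∀ v : 𝔞,
    maurerCartan ι (g x) (mfderiv 𝓘(ℝ, 𝔞) 𝓘(ℝ, E) g x v) = (v : 𝔤) + ⁅(v : 𝔤), (F x : 𝔤)⁆

end LieGroups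

/-! Since `Q_p(A) = [A, p]` and all these brackets lie in the span of the `B_j`, the generators
vanish along `Φ = (g, F)` exactly when `θ = g⁻¹dg` has the form `α + [α, F]`, with `α` the `𝔞`-part
of `θ` in the adapted basis (`AdaptedBasis.coord_eq_iff`, `pullback_gens_eq_zero_iff`). The
independence condition says that `α` is a coframe.

Insert this form into the Maurer–Cartan equation `dθ(v, w) = -[θ(v), θ(w)]`. As `𝔞` is abelian,
`ad_a` and `ad_b` commute for `a, b ∈ 𝔞`, the mixed terms of the bracket cancel, and `[[α(v), F],
[α(w), F]] ∈ 𝔤₀` remains. The `𝔤₁`-component gives `dα = 0`; the `𝔤₀`-component is then the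
`G/G₀`-system in terms of `α` (`structure_of_maurerCartan_eq`).

For the local converse, the Poincaré lemma on a ball gives `f` with `df = α`, and the inverse
function theorem makes `f` a chart with values in `𝔞`, in which `α` is tautological
(`exists_coordinates_of_maurerCartan_eq`). When `α` is tautological from the outset, no change of
coordinates is needed and the conclusion is global. -/

open VectorField Set Filter Topology

/-! ### Left-invariant fields in charts and the Maurer–Cartan equation. -/

section ChartFields

set_option linter.unusedSectionVars false

variable {E : Type*} [NormedAddCommGroup E] [NormedSpace ℝ E] [CompleteSpace E]
  {G : Type*} [TopologicalSpace G] [ChartedSpace E G] [Group G] [LieGroup 𝓘(ℝ, E) ∞ G]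

/-- A left-invariant vector field, read in the preferred chart at `g₀`. -/
noncomputable def chartField (g₀ : G) (X : GroupLieAlgebra 𝓘(ℝ, E) G) (e : E) : E :=
  mpullbackWithin 𝓘(ℝ, E) 𝓘(ℝ, E) (extChartAt 𝓘(ℝ, E) g₀).symm
    (mulInvariantVectorField X) (range 𝓘(ℝ, E)) e

theorem chartField_add (g₀ : G) (X Y : GroupLieAlgebra 𝓘(ℝ, E) G) (e : E) :
    chartField g₀ (X + Y) e = chartField g₀ X e + chartField g₀ Y e := by
  simp only [chartField, mulInvariantVectorField_add]
  exact mpullbackWithin_add_apply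

theorem chartField_smul (g₀ : G) (c : ℝ) (X : GroupLieAlgebra 𝓘(ℝ, E) G) (e : E) :
    chartField g₀ (c • X) e = c • chartField g₀ X e := by
  simp only [chartField, mulInvariantVectorField_smul]
  exact mpullbackWithin_const_smul_apply

variable (E G) in
theorem LieGroup.isManifold_infty : IsManifold 𝓘(ℝ, E) ∞ G :=
  LieGroup.toContMDiffMul.toIsManifold

variable (E G) in
theorem LieGroup.isManifold_of_smooth (n : ℕ) : IsManifold 𝓘(ℝ, E) n G :=
  have : IsManifold 𝓘(ℝ, E) ∞ G := LieGroup.isManifold_infty E G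
  IsManifold.of_le (n := ∞) (WithTop.coe_le_coe.2 (le_top : (n : ℕ∞) ≤ ⊤))

/-- The centre of the chart is enough: the structure equation at `x` is proved in the chart centred
at `g x`. -/
theorem differentiableAt_chartField (g₀ : G) (X : GroupLieAlgebra 𝓘(ℝ, E) G) :
    DifferentiableAt ℝ (chartField g₀ X) (extChartAt 𝓘(ℝ, E) g₀ g₀) := by
  have : IsManifold 𝓘(ℝ, E) 2 G := LieGroup.isManifold_of_smooth E G 2
  have h := MDifferentiableWithinAt.differentiableWithinAt_mpullbackWithin_vectorField
    (mdifferentiableAt_mulInvariantVectorField X (g := g₀)).mdifferentiableWithinAt (s := univ)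
  rw [show (extChartAt 𝓘(ℝ, E) g₀).symm ⁻¹' univ ∩ range 𝓘(ℝ, E) = univ by simp] at h
  exact differentiableWithinAt_univ.1 h

theorem chartField_eq_of_mfderivWithin_eq {g₀ : G} {X : GroupLieAlgebra 𝓘(ℝ, E) G} {e u : E}
    (he : e ∈ (extChartAt 𝓘(ℝ, E) g₀).target)
    (hu : mfderivWithin 𝓘(ℝ, E) 𝓘(ℝ, E) (extChartAt 𝓘(ℝ, E) g₀).symm (range 𝓘(ℝ, E)) e u =
      mulInvariantVectorField X ((extChartAt 𝓘(ℝ, E) g₀).symm e)) :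
    chartField g₀ X e = u := by
  have : IsManifold 𝓘(ℝ, E) 1 G := LieGroup.isManifold_of_smooth E G 1
  obtain ⟨M, hM⟩ := isInvertible_mfderivWithin_extChartAt_symm he
  rw [chartField, mpullbackWithin_apply, ← hu, ← hM, ContinuousLinearMap.inverse_equiv]
  exact M.symm_apply_apply u

/-- The base points are only propositionally equal, so both vectors are read in the model space `E`.
-/
theorem mulInvariantVectorField_extChartAt_symm {g₀ h : G}
    (hh : h ∈ (extChartAt 𝓘(ℝ, E) g₀).source) (X : GroupLieAlgebra 𝓘(ℝ, E) G) :
    (mulInvariantVectorField X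
      ((extChartAt 𝓘(ℝ, E) g₀).symm (extChartAt 𝓘(ℝ, E) g₀ h)) : E) =
      mulInvariantVectorField X h :=
  congrArg (fun p : G => (mulInvariantVectorField X p : E)) ((extChartAt 𝓘(ℝ, E) g₀).left_inv hh)

theorem chartField_self (g₀ : G) (X : GroupLieAlgebra 𝓘(ℝ, E) G) :
    chartField g₀ X (extChartAt 𝓘(ℝ, E) g₀ g₀) = mulInvariantVectorField X g₀ := by
  have : IsManifold 𝓘(ℝ, E) 1 G := LieGroup.isManifold_of_smooth E G 1
  refine chartField_eq_of_mfderivWithin_eq (mem_extChartAt_target g₀) ?_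
  rw [mfderivWithin_range_extChartAt_symm]
  exact (mulInvariantVectorField_extChartAt_symm (mem_extChartAt_source g₀) X).symm

/-- The manifold bracket is computed by pulling back to the chart, whose derivative at its centre is
the identity; the bracket of left-invariant fields is again left-invariant. -/
theorem lieBracket_chartField (g₀ : G) (X Y : GroupLieAlgebra 𝓘(ℝ, E) G) :
    lieBracket ℝ (chartField g₀ X) (chartField g₀ Y) (extChartAt 𝓘(ℝ, E) g₀ g₀) =
      chartField g₀ ⁅X, Y⁆ (extChartAt 𝓘(ℝ, E) g₀ g₀) := by
  have : IsManifold 𝓘(ℝ, E) 1 G := LieGroup.isManifold_of_smooth E G 1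
  rw [chartField_self, GroupLieAlgebra.bracket_def, mulInvariantVector_mlieBracket,
    ← mlieBracketWithin_univ, mlieBracketWithin_apply, mfderiv_extChartAt_self,
    show (extChartAt 𝓘(ℝ, E) g₀).symm ⁻¹' univ ∩ range 𝓘(ℝ, E) = univ by simp,
    ← lieBracketWithin_univ]
  exact (DFunLike.congr_fun (ContinuousLinearMap.inverse_id (R := ℝ) (M := E)) _).symm

theorem mulInvariantVectorField_mfderiv_inv_mul (h : G) (w : TangentSpace 𝓘(ℝ, E) h) :
    mulInvariantVectorField (I := 𝓘(ℝ, E))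
      (mfderiv 𝓘(ℝ, E) 𝓘(ℝ, E) (fun b : G => h⁻¹ * b) h w : TangentSpace 𝓘(ℝ, E) (1 : G)) h =
      w := by
  have hd : ∀ a b : G, MDifferentiableAt 𝓘(ℝ, E) 𝓘(ℝ, E) (fun x : G => a * x) b := fun a b =>
    (contMDiff_mul_left (I := 𝓘(ℝ, E)) (n := ∞)).contMDiffAt.mdifferentiableAt (by simp)
  have key : mfderiv 𝓘(ℝ, E) 𝓘(ℝ, E) ((fun x : G => h * x) ∘ fun x => h⁻¹ * x) h w = w := by
    rw [show ((fun x : G => h * x) ∘ fun x => h⁻¹ * x) = id by ext; simp, mfderiv_id]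
    rfl
  rw [mfderiv_comp (I' := 𝓘(ℝ, E)) _ (hd _ _) (hd _ _)] at key
  have hr : (fun p : G => (mfderiv 𝓘(ℝ, E) 𝓘(ℝ, E) (fun x : G => h * x) p : E →L[ℝ] E)) (h⁻¹ * h) =
      (fun p : G => (mfderiv 𝓘(ℝ, E) 𝓘(ℝ, E) (fun x : G => h * x) p : E →L[ℝ] E)) 1 :=
    congrArg _ (inv_mul_cancel h)
  exact (DFunLike.congr_fun hr _).symm.trans key

variable {V : Type*} [NormedAddCommGroup V] [NormedSpace ℝ V]

variable (E) in
/-- The pullback of the Maurer--Cartan form, with values in the tangent space at the identity. -/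
noncomputable def logDerivative (g : V → G) (x : V) : V →L[ℝ] E :=
  fderiv ℝ (fun y => extChartAt 𝓘(ℝ, E) (1 : G) ((g x)⁻¹ * g y)) x

/-- Translation by `(g x)⁻¹` moves `g x` to `1`, so the single chart at `1` serves for all `x`, and
its derivative there is the identity. -/
theorem logDerivative_apply {g : V → G} {x : V} (hg : MDifferentiableAt 𝓘(ℝ, V) 𝓘(ℝ, E) g x)
    (v : V) : logDerivative E g x v =
      (mfderiv 𝓘(ℝ, E) 𝓘(ℝ, E) (fun b : G => (g x)⁻¹ * b) (g x)
        (mfderiv 𝓘(ℝ, V) 𝓘(ℝ, E) g x v) : TangentSpace 𝓘(ℝ, E) ((g x)⁻¹ * g x)) := by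
  have hm : MDifferentiableAt 𝓘(ℝ, E) 𝓘(ℝ, E) (fun b : G => (g x)⁻¹ * b) (g x) :=
    (contMDiff_mul_left (I := 𝓘(ℝ, E)) (n := ∞)).contMDiffAt.mdifferentiableAt (by simp)
  have h := mfderiv_comp (I' := 𝓘(ℝ, E)) x hm hg
  have h2 : (mfderiv 𝓘(ℝ, V) 𝓘(ℝ, E) ((fun b : G => (g x)⁻¹ * b) ∘ g) x : V →L[ℝ] E) =
      logDerivative E g x := by
    refine (hm.comp x hg).mfderiv.trans ?_
    simp only [writtenInExtChartAt, logDerivative, Function.comp_def, inv_mul_cancel]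
    simp only [mfld_simps, fderivWithin_univ]
    rfl
  refine (DFunLike.congr_fun h2 v).symm.trans ?_
  exact DFunLike.congr_fun h v

/-- It is the partial derivative in the second variable, taken on the diagonal, of the function `K`
below, which is smooth near `(x, x)`. -/
theorem contDiffOn_logDerivative {g : V → G} {U : Set V} (hU : IsOpen U)
    (hg : ContMDiffOn 𝓘(ℝ, V) 𝓘(ℝ, E) ∞ g U) : ContDiffOn ℝ ∞ (logDerivative E g) U := by
  intro x hx
  refine ContDiffAt.contDiffWithinAt ?_
  have : IsManifold 𝓘(ℝ, E) ∞ G := LieGroup.isManifold_infty E G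
  set K : V × V → E := fun p => extChartAt 𝓘(ℝ, E) (1 : G) ((g p.1)⁻¹ * g p.2) with hK
  have hgx : ContMDiffAt 𝓘(ℝ, V) 𝓘(ℝ, E) ∞ g x := hg.contMDiffAt (hU.mem_nhds hx)
  have hKs : ContDiffAt ℝ ∞ K (x, x) := by
    rw [← contMDiffAt_iff_contDiffAt]
    have h1 : ContMDiffAt 𝓘(ℝ, V × V) 𝓘(ℝ, E) ∞ (fun p : V × V => g p.1) (x, x) :=
      ContMDiffAt.comp (x, x) (I' := 𝓘(ℝ, V)) hgx contDiff_fst.contMDiff.contMDiffAt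
    have h2 : ContMDiffAt 𝓘(ℝ, V × V) 𝓘(ℝ, E) ∞ (fun p : V × V => g p.2) (x, x) :=
      ContMDiffAt.comp (x, x) (I' := 𝓘(ℝ, V)) hgx contDiff_snd.contMDiff.contMDiffAt
    refine ContMDiffAt.comp (x, x) (I' := 𝓘(ℝ, E)) ?_ (h1.inv.mul h2)
    simp only [inv_mul_cancel]
    exact contMDiffAt_extChartAt
  have hKe : ∀ᶠ p in 𝓝 (x, x), DifferentiableAt ℝ K p := by
    have := (hKs.of_le (m := 1) (by simp)).eventually (by simp)
    exact this.mono fun p hp => hp.differentiableAt (by simp)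
  have hdiag : Tendsto (fun y : V => (y, y)) (𝓝 x) (𝓝 (x, x)) :=
    (continuous_id.prodMk continuous_id).tendsto x
  have heq : logDerivative E g =ᶠ[𝓝 x]
      fun y => (fderiv ℝ K (y, y)).comp (ContinuousLinearMap.inr ℝ V V) := by
    filter_upwards [hdiag.eventually hKe] with y hy
    exact (hy.hasFDerivAt.comp y (hasFDerivAt_prodMk_right y y)).fderiv
  refine ContDiffAt.congr_of_eventuallyEq ?_ heq
  refine ContDiffAt.clm_comp ?_ contDiffAt_const
  exact ContDiffAt.comp x (hKs.fderiv_right (m := ∞) (by simp))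
    (contDiff_id.prodMk contDiff_id).contDiffAt

/-- `dg(v)` is the value at `g x` of the left-invariant field generated by `θ(v)`. In a chart this
reads `u' = W(u) θ`; it holds off the centre too, so it can be differentiated again. -/
theorem fderiv_extChartAt_comp {g : V → G} {g₀ : G} {x : V}
    (hx : g x ∈ (extChartAt 𝓘(ℝ, E) g₀).source) (hg : ContMDiffAt 𝓘(ℝ, V) 𝓘(ℝ, E) ∞ g x)
    (v : V) : fderiv ℝ (fun y => extChartAt 𝓘(ℝ, E) g₀ (g y)) x v =
      chartField g₀ (logDerivative E g x v) (extChartAt 𝓘(ℝ, E) g₀ (g x)) := by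
  have : IsManifold 𝓘(ℝ, E) 1 G := LieGroup.isManifold_of_smooth E G 1
  have hgd := hg.mdifferentiableAt (by simp)
  set c := extChartAt 𝓘(ℝ, E) g₀ with hc
  have hcx : MDifferentiableAt 𝓘(ℝ, E) 𝓘(ℝ, E) c (g x) :=
    mdifferentiableAt_extChartAt (by simpa [hc] using hx)
  have e1 : fderiv ℝ (fun y => c (g y)) x v =
      mfderiv 𝓘(ℝ, E) 𝓘(ℝ, E) c (g x) (mfderiv 𝓘(ℝ, V) 𝓘(ℝ, E) g x v) := by
    rw [← mfderiv_eq_fderiv]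
    have := mfderiv_comp (I' := 𝓘(ℝ, E)) x hcx hgd
    simp only [Function.comp_def] at this
    rw [this]
    rfl
  rw [e1]
  refine (chartField_eq_of_mfderivWithin_eq (c.map_source hx) ?_).symm
  refine Eq.trans ?_ (mulInvariantVectorField_extChartAt_symm hx _).symm
  rw [logDerivative_apply hgd]
  refine Eq.trans ?_ (mulInvariantVectorField_mfderiv_inv_mul (g x) _).symm
  exact DFunLike.congr_fun
    (mfderivWithin_extChartAt_symm_comp_mfderiv_extChartAt' (I := 𝓘(ℝ, E)) hx) _

theorem mulInvariantVectorField_injective (h : G) :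
    Function.Injective fun X : GroupLieAlgebra 𝓘(ℝ, E) G => mulInvariantVectorField X h := by
  have hd : ∀ a b : G, MDifferentiableAt 𝓘(ℝ, E) 𝓘(ℝ, E) (fun x : G => a * x) b := fun a b =>
    (contMDiff_mul_left (I := 𝓘(ℝ, E)) (n := ∞)).contMDiffAt.mdifferentiableAt (by simp)
  refine Function.LeftInverse.injective
    (g := mfderiv 𝓘(ℝ, E) 𝓘(ℝ, E) (fun x : G => h⁻¹ * x) h) fun X => ?_
  have key : mfderiv 𝓘(ℝ, E) 𝓘(ℝ, E) ((fun x : G => h⁻¹ * x) ∘ fun x => h * x) 1 X = X := by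
    rw [show ((fun x : G => h⁻¹ * x) ∘ fun x => h * x) = id by ext; simp, mfderiv_id]
    rfl
  rw [mfderiv_comp (I' := 𝓘(ℝ, E)) _ (hd _ _) (hd _ _)] at key
  have hr : (fun p : G => (mfderiv 𝓘(ℝ, E) 𝓘(ℝ, E) (fun x : G => h⁻¹ * x) p : E →L[ℝ] E)) (h * 1) =
      (fun p : G => (mfderiv 𝓘(ℝ, E) 𝓘(ℝ, E) (fun x : G => h⁻¹ * x) p : E →L[ℝ] E)) h :=
    congrArg _ (mul_one h)
  exact (DFunLike.congr_fun hr _).symm.trans key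

variable [FiniteDimensional ℝ E]

/-- The left-invariant vector fields in a chart, as a field of linear maps. -/
noncomputable def chartFrame (g₀ : G) (e : E) : E →L[ℝ] E :=
  LinearMap.toContinuousLinearMap
    { toFun := fun X : E => chartField g₀ (X : GroupLieAlgebra 𝓘(ℝ, E) G) e
      map_add' := fun X Y => chartField_add g₀ X Y e
      map_smul' := fun c X => chartField_smul g₀ c X e }

theorem differentiableAt_of_forall_clm_apply {D F : Type*} [NormedAddCommGroup D]
    [NormedSpace ℝ D] [NormedAddCommGroup F] [NormedSpace ℝ F] {f : D → E →L[ℝ] F} {x : D}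
    (h : ∀ v, DifferentiableAt ℝ (fun y => f y v) x) : DifferentiableAt ℝ f x := by
  let b := Module.finBasis ℝ E
  have hf : f = fun y => ∑ i, (LinearMap.toContinuousLinearMap (b.coord i)).smulRight (f y (b i)) := by
    funext y
    ext v
    refine (congrArg (f y) (b.sum_repr v).symm).trans ?_
    rw [map_sum]
    simp
  rw [hf]
  refine DifferentiableAt.fun_sum fun i _ => ?_
  exact ((ContinuousLinearMap.smulRightL ℝ E F
    (LinearMap.toContinuousLinearMap (b.coord i))).differentiableAt).comp x (h (b i))

/-- The Maurer--Cartan structure equation. -/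
theorem fderiv_logDerivative_sub {g : V → G} {U : Set V} (hU : IsOpen U)
    (hg : ContMDiffOn 𝓘(ℝ, V) 𝓘(ℝ, E) ∞ g U) {x : V} (hx : x ∈ U) (v w : V)
    {X Y : GroupLieAlgebra 𝓘(ℝ, E) G} (hX : X = logDerivative E g x v)
    (hY : Y = logDerivative E g x w) :
    fderiv ℝ (logDerivative E g) x w v - fderiv ℝ (logDerivative E g) x v w =
      (⁅X, Y⁆ : GroupLieAlgebra 𝓘(ℝ, E) G) := by
  have : IsManifold 𝓘(ℝ, E) ∞ G := LieGroup.isManifold_infty E G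
  have hgx : ContMDiffAt 𝓘(ℝ, V) 𝓘(ℝ, E) ∞ g x := hg.contMDiffAt (hU.mem_nhds hx)
  set θ := logDerivative E g with hθ
  set W := chartFrame (E := E) (g x)
  set u : V → E := fun y => extChartAt 𝓘(ℝ, E) (g x) (g y)
  have hus : ContDiffAt ℝ ∞ u x := by
    rw [← contMDiffAt_iff_contDiffAt]
    exact ContMDiffAt.comp x (I' := 𝓘(ℝ, E)) contMDiffAt_extChartAt hgx
  have hWd : DifferentiableAt ℝ W (u x) :=
    differentiableAt_of_forall_clm_apply fun X => differentiableAt_chartField (g x) X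
  have hθd : DifferentiableAt ℝ θ x :=
    ((contDiffOn_logDerivative hU hg).contDiffAt (hU.mem_nhds hx)).differentiableAt (by simp)
  have hud : HasFDerivAt u (fderiv ℝ u x) x := (hus.differentiableAt (by simp)).hasFDerivAt
  have heq : ∀ᶠ y in 𝓝 x, ∀ t, fderiv ℝ u y t = W (u y) (θ y t) := by
    filter_upwards [hU.mem_nhds hx, hgx.continuousAt.preimage_mem_nhds
      (extChartAt_source_mem_nhds (I := 𝓘(ℝ, E)) (g x))] with y hy hy' t
    exact fderiv_extChartAt_comp hy' (hg.contMDiffAt (hU.mem_nhds hy)) t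
  -- Product rule applied to `u' = W(u) θ`.
  have hsnd : ∀ s t, fderiv ℝ (fderiv ℝ u) x s t =
      fderiv ℝ W (u x) (W (u x) (θ x s)) (θ x t) + W (u x) (fderiv ℝ θ x s t) := by
    intro s t
    have h1 : HasFDerivAt (fun y => fderiv ℝ u y t)
        ((fderiv ℝ (fderiv ℝ u) x).flip t) x := by
      have := (((hus.fderiv_right (m := ∞) (by simp)).differentiableAt
        (by simp)).hasFDerivAt).clm_apply (hasFDerivAt_const t x)
      simpa using this
    have h2 := ((hWd.hasFDerivAt.comp x hud).clm_apply
      ((hθd.hasFDerivAt).clm_apply (hasFDerivAt_const t x)))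
    have h3 := h1.unique (h2.congr_of_eventuallyEq (heq.mono fun y hy => hy t))
    have h4 := DFunLike.congr_fun h3 s
    simp only [ContinuousLinearMap.flip_apply] at h4
    rw [h4]
    simp [heq.self_of_nhds s, add_comm]
  -- Antisymmetrizing the second derivative gives zero; the terms with `DW` then form the bracket of
  -- two chart fields, and `W` is cancelled by injectivity.
  have hsym : fderiv ℝ (fderiv ℝ u) x v w = fderiv ℝ (fderiv ℝ u) x w v :=
    (hus.isSymmSndFDerivAt (by simpa using! WithTop.coe_le_coe.2 (le_top : (2 : ℕ∞) ≤ ⊤))).eq v w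
  rw [hsnd, hsnd] at hsym
  have hDW : ∀ (a : E) (X : GroupLieAlgebra 𝓘(ℝ, E) G),
      fderiv ℝ (chartField (g x) X) (u x) a = fderiv ℝ W (u x) a X := by
    intro a X
    have := hWd.hasFDerivAt.clm_apply (hasFDerivAt_const (X : E) (u x))
    have h2 : HasFDerivAt (chartField (g x) X) _ (u x) := this
    rw [h2.fderiv]
    change W (u x) 0 + fderiv ℝ W (u x) a X = _
    rw [map_zero, zero_add]
  have hbr := lieBracket_chartField (g x) X Y
  rw [lieBracket] at hbr
  have hbr' : fderiv ℝ W (u x) (W (u x) (θ x v)) (θ x w) -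
      fderiv ℝ W (u x) (W (u x) (θ x w)) (θ x v) =
      W (u x) (⁅X, Y⁆ : GroupLieAlgebra 𝓘(ℝ, E) G) := by
    rw [← hX, ← hY, ← hDW, ← hDW]
    exact hbr
  have hinj : Function.Injective (W (u x)) := by
    intro X Y hXY
    apply mulInvariantVectorField_injective (E := E) (g x)
    have := (chartField_self (g x) X).symm.trans (hXY.trans (chartField_self (g x) Y))
    exact this
  apply hinj
  rw [map_sub, ← hbr', sub_eq_sub_iff_add_eq_add, add_comm, ← hsym, add_comm]

end ChartFields

/-! ### Forms `α + [α, F]`: structure equation and straightening coordinates. -/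

section Primitives

variable {E : Type*} [NormedAddCommGroup E] [NormedSpace ℝ E] [CompleteSpace E]
  [FiniteDimensional ℝ E]
  {G : Type*} [TopologicalSpace G] [ChartedSpace E G] [Group G] [LieGroup 𝓘(ℝ, E) ∞ G]
  {𝔤 : Type*} [NormedLieRing 𝔤] [NormedLieAlgebra 𝔤]
  {V : Type*} [NormedAddCommGroup V] [NormedSpace ℝ V]

/-- The Lie bracket of a finite-dimensional Lie algebra as a continuous bilinear map. -/
noncomputable def lieCLM (𝔤 : Type*) [NormedLieRing 𝔤] [NormedLieAlgebra 𝔤]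
    [FiniteDimensional ℝ 𝔤] : 𝔤 →L[ℝ] 𝔤 →L[ℝ] 𝔤 :=
  LinearMap.toContinuousBilinearMap (LieModule.toEnd ℝ 𝔤 𝔤 : 𝔤 →ₗ[ℝ] 𝔤 →ₗ[ℝ] 𝔤)

@[simp]
theorem lieCLM_apply [FiniteDimensional ℝ 𝔤] (X Y : 𝔤) : lieCLM 𝔤 X Y = ⁅X, Y⁆ := rfl

/-- The identification of the tangent space at the identity with the Lie algebra. -/
noncomputable def tangentOneCLM (ι : 𝔤 ≃ₗ⁅ℝ⁆ GroupLieAlgebra 𝓘(ℝ, E) G) : E →L[ℝ] 𝔤 :=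
  LinearMap.toContinuousLinearMap
    { toFun := fun X : E => ι.symm (X : GroupLieAlgebra 𝓘(ℝ, E) G)
      map_add' := fun X Y => map_add ι.symm (X : GroupLieAlgebra 𝓘(ℝ, E) G) Y
      map_smul' := fun c X => map_smul ι.symm c (X : GroupLieAlgebra 𝓘(ℝ, E) G) }

theorem maurerCartan_mfderiv (ι : 𝔤 ≃ₗ⁅ℝ⁆ GroupLieAlgebra 𝓘(ℝ, E) G) {g : V → G} {x : V}
    (hg : MDifferentiableAt 𝓘(ℝ, V) 𝓘(ℝ, E) g x) (v : V) :
    maurerCartan ι (g x) (mfderiv 𝓘(ℝ, V) 𝓘(ℝ, E) g x v) =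
      tangentOneCLM ι (logDerivative E g x v) := by
  rw [logDerivative_apply hg]
  rfl

/-- The Maurer--Cartan equation for the pullback of the Maurer--Cartan form. -/
theorem maurerCartan_structure (ι : 𝔤 ≃ₗ⁅ℝ⁆ GroupLieAlgebra 𝓘(ℝ, E) G) {g : V → G} {U : Set V}
    (hU : IsOpen U) (hg : ContMDiffOn 𝓘(ℝ, V) 𝓘(ℝ, E) ∞ g U) {x : V} (hx : x ∈ U) (v w : V) :
    tangentOneCLM ι (fderiv ℝ (logDerivative E g) x w v) -
        tangentOneCLM ι (fderiv ℝ (logDerivative E g) x v w) =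
      ⁅tangentOneCLM ι (logDerivative E g x v), tangentOneCLM ι (logDerivative E g x w)⁆ := by
  rw [← map_sub, fderiv_logDerivative_sub hU hg hx v w rfl rfl]
  exact LieEquiv.map_lie ι.symm _ _

variable {𝔤₀ 𝔤₁ 𝔞 : Submodule ℝ 𝔤}

theorem IsMaximalAbelianIn.lie_eq_zero (ha : IsMaximalAbelianIn 𝔤₁ 𝔞) (a b : 𝔞) :
    ⁅(a : 𝔤), (b : 𝔤)⁆ = 0 := ha.prop.2 a a.2 b b.2

theorem IsCartanDecomposition.lie_mem_zero (hd : IsCartanDecomposition 𝔤₀ 𝔤₁)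
    (ha : IsMaximalAbelianIn 𝔤₁ 𝔞) (a : 𝔞) (p : cartanM 𝔤₁ 𝔞) : ⁅(a : 𝔤), (p : 𝔤)⁆ ∈ 𝔤₀ :=
  hd.lie_one_one _ (ha.prop.1 a.2) _ p.2.2

/-- Used to split off the `𝔤₁`-component of the structure equation. -/
theorem IsCartanDecomposition.eq_zero_of_add_eq_zero (hd : IsCartanDecomposition 𝔤₀ 𝔤₁)
    (ha : IsMaximalAbelianIn 𝔤₁ 𝔞) {a : 𝔞} {z : 𝔤} (hz : z ∈ 𝔤₀) (h : (a : 𝔤) + z = 0) :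
    a = 0 := by
  have h1 : (a : 𝔤) ∈ 𝔤₀ := by
    rw [eq_neg_of_add_eq_zero_left h]
    exact neg_mem hz
  exact Subtype.ext (Submodule.disjoint_def.1 hd.isCompl.disjoint _ h1 (ha.prop.1 a.2))

variable [FiniteDimensional ℝ 𝔤]

/-- If the Maurer--Cartan form pulls back to `α + [α, F]`, then `α` is closed and `F` satisfies
the first-order system expressed in terms of `α`. -/
theorem structure_of_maurerCartan_eq (ι : 𝔤 ≃ₗ⁅ℝ⁆ GroupLieAlgebra 𝓘(ℝ, E) G)
    (hd : IsCartanDecomposition 𝔤₀ 𝔤₁) (ha : IsMaximalAbelianIn 𝔤₁ 𝔞) {g : V → G} {U : Set V}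
    (hU : IsOpen U) (hg : ContMDiffOn 𝓘(ℝ, V) 𝓘(ℝ, E) ∞ g U) {F : V → cartanM 𝔤₁ 𝔞}
    (hF : DifferentiableOn ℝ F U) {α : V → V →L[ℝ] 𝔞} (hα : DifferentiableOn ℝ α U)
    (hθ : ∀ x ∈ U, ∀ v : V, maurerCartan ι (g x) (mfderiv 𝓘(ℝ, V) 𝓘(ℝ, E) g x v) =
      (α x v : 𝔤) + ⁅(α x v : 𝔤), (F x : 𝔤)⁆) {x : V} (hx : x ∈ U) (v w : V) :
    fderiv ℝ α x v w = fderiv ℝ α x w v ∧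
      ⁅(α x v : 𝔤), (fderiv ℝ F x w : 𝔤)⁆ - ⁅(α x w : 𝔤), (fderiv ℝ F x v : 𝔤)⁆ =
        ⁅⁅(α x v : 𝔤), (F x : 𝔤)⁆, ⁅(α x w : 𝔤), (F x : 𝔤)⁆⁆ := by
  have hgd : ∀ y ∈ U, MDifferentiableAt 𝓘(ℝ, V) 𝓘(ℝ, E) g y := fun y hy =>
    (hg.contMDiffAt (hU.mem_nhds hy)).mdifferentiableAt (by simp)
  have hval : ∀ y ∈ U, ∀ t, tangentOneCLM ι (logDerivative E g y t) =
      (α y t : 𝔤) + ⁅(α y t : 𝔤), (F y : 𝔤)⁆ := fun y hy t =>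
    (maurerCartan_mfderiv ι (hgd y hy) t).symm.trans (hθ y hy t)
  have hder : ∀ s t, tangentOneCLM ι (fderiv ℝ (logDerivative E g) x s t) =
      (fderiv ℝ α x s t : 𝔤) + (⁅(fderiv ℝ α x s t : 𝔤), (F x : 𝔤)⁆ +
        ⁅(α x t : 𝔤), (fderiv ℝ F x s : 𝔤)⁆) := by
    intro s t
    have h1 := (((contDiffOn_logDerivative hU hg).contDiffAt (hU.mem_nhds hx)).differentiableAt
      (by simp)).hasFDerivAt.clm_apply (hasFDerivAt_const t x)
    have h1' := (tangentOneCLM ι).hasFDerivAt.comp x h1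
    have h2 := ((hα.differentiableAt (hU.mem_nhds hx)).hasFDerivAt.clm_apply
      (hasFDerivAt_const t x))
    have h2' := 𝔞.subtypeL.hasFDerivAt.comp x h2
    have h3 := (cartanM 𝔤₁ 𝔞).subtypeL.hasFDerivAt.comp x
      (hF.differentiableAt (hU.mem_nhds hx)).hasFDerivAt
    have h4 := h2'.add (((lieCLM 𝔤).hasFDerivAt.comp x h2').clm_apply h3)
    have h5 := h1'.unique (h4.congr_of_eventuallyEq
      (Filter.eventually_of_mem (hU.mem_nhds hx) fun y hy => hval y hy t))
    have h6 := DFunLike.congr_fun h5 s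
    simpa [add_comm, add_left_comm] using h6
  have hmc := maurerCartan_structure ι hU hg hx v w
  rw [hder, hder, hval x hx, hval x hx] at hmc
  have hab := ha.lie_eq_zero (α x v) (α x w)
  -- Jacobi identity with `[α(v), α(w)] = 0`.
  have hjac : ⁅(α x v : 𝔤), ⁅(α x w : 𝔤), (F x : 𝔤)⁆⁆ =
      ⁅(α x w : 𝔤), ⁅(α x v : 𝔤), (F x : 𝔤)⁆⁆ := by
    rw [leibniz_lie, hab, zero_lie, zero_add]
  have hexp : ⁅(α x v : 𝔤) + ⁅(α x v : 𝔤), (F x : 𝔤)⁆,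
      (α x w : 𝔤) + ⁅(α x w : 𝔤), (F x : 𝔤)⁆⁆ =
      ⁅⁅(α x v : 𝔤), (F x : 𝔤)⁆, ⁅(α x w : 𝔤), (F x : 𝔤)⁆⁆ := by
    rw [lie_add, add_lie, add_lie, hab, hjac, ← lie_skew (⁅(α x v : 𝔤), (F x : 𝔤)⁆) (α x w : 𝔤)]
    abel
  rw [hexp] at hmc
  -- `δ = -dα(v, w)` lies in `𝔞 ⊆ 𝔤₁`, while every other term of `hmc` lies in `𝔤₀`.
  set δ : 𝔞 := fderiv ℝ α x w v - fderiv ℝ α x v w with hδ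
  have hδc : (δ : 𝔤) = (fderiv ℝ α x w v : 𝔤) - (fderiv ℝ α x v w : 𝔤) := rfl
  have hδ0 : δ = 0 := by
    refine hd.eq_zero_of_add_eq_zero ha (z := ⁅(δ : 𝔤), (F x : 𝔤)⁆ +
      (⁅(α x v : 𝔤), (fderiv ℝ F x w : 𝔤)⁆ - ⁅(α x w : 𝔤), (fderiv ℝ F x v : 𝔤)⁆) -
      ⁅⁅(α x v : 𝔤), (F x : 𝔤)⁆, ⁅(α x w : 𝔤), (F x : 𝔤)⁆⁆) ?_ ?_
    · exact sub_mem (add_mem (hd.lie_mem_zero ha _ _)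
        (sub_mem (hd.lie_mem_zero ha _ _) (hd.lie_mem_zero ha _ _)))
        (hd.lie_zero_zero _ (hd.lie_mem_zero ha _ _) _ (hd.lie_mem_zero ha _ _))
    · rw [← hmc, hδc, sub_lie]
      abel
  have heq : fderiv ℝ α x w v = fderiv ℝ α x v w := sub_eq_zero.1 hδ0
  refine ⟨heq.symm, ?_⟩
  rw [← hmc, heq]
  abel

/-- The Maurer--Cartan equation for a primitive of `α + [α, F]` is the `G/G₀`-system. -/
theorem IsPrimitive.isSystemSolution {ι : 𝔤 ≃ₗ⁅ℝ⁆ GroupLieAlgebra 𝓘(ℝ, E) G}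
    (hd : IsCartanDecomposition 𝔤₀ 𝔤₁) (ha : IsMaximalAbelianIn 𝔤₁ 𝔞) {k : ℕ}
    (A : Module.Basis (Fin k) ℝ 𝔞) {U : Set 𝔞} (hU : IsOpen U) {F : 𝔞 → cartanM 𝔤₁ 𝔞}
    {g : 𝔞 → G} (hF : ContDiffOn ℝ ∞ F U) (hg : IsPrimitive ι U F g) :
    IsSystemSolution A U F :=
  ⟨hF, fun _ hx i j _ => (structure_of_maurerCartan_eq ι hd ha hU hg.1
    (hF.differentiableOn (by simp)) (differentiableOn_const (ContinuousLinearMap.id ℝ 𝔞)) hg.2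
    hx (A i) (A j)).2⟩

/-- A form `α + [α, F]` with `α` pointwise injective is brought to the tautological one by a local
change of coordinates. -/
theorem exists_coordinates_of_maurerCartan_eq [FiniteDimensional ℝ V]
    (ι : 𝔤 ≃ₗ⁅ℝ⁆ GroupLieAlgebra 𝓘(ℝ, E) G)
    (hd : IsCartanDecomposition 𝔤₀ 𝔤₁) (ha : IsMaximalAbelianIn 𝔤₁ 𝔞) {g : V → G} {U : Set V}
    (hU : IsOpen U) (hg : ContMDiffOn 𝓘(ℝ, V) 𝓘(ℝ, E) ∞ g U) {F : V → cartanM 𝔤₁ 𝔞}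
    (hF : ContDiffOn ℝ ∞ F U) (hdim : Module.finrank ℝ V = Module.finrank ℝ 𝔞)
    (hθ : ∀ x ∈ U, ∃ a : V →ₗ[ℝ] 𝔞, Function.Injective a ∧
      ∀ v : V, maurerCartan ι (g x) (mfderiv 𝓘(ℝ, V) 𝓘(ℝ, E) g x v) =
        (a v : 𝔤) + ⁅(a v : 𝔤), (F x : 𝔤)⁆) {x₀ : V} (hx₀ : x₀ ∈ U) :
    ∃ χ : OpenPartialHomeomorph 𝔞 V, x₀ ∈ χ.target ∧ χ.target ⊆ U ∧
      ContDiffOn ℝ ∞ χ χ.source ∧ ContDiffOn ℝ ∞ χ.symm χ.target ∧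
      IsPrimitive ι χ.source (F ∘ χ) (g ∘ χ) := by
  have hgd : ∀ y ∈ U, MDifferentiableAt 𝓘(ℝ, V) 𝓘(ℝ, E) g y := fun y hy =>
    (hg.contMDiffAt (hU.mem_nhds hy)).mdifferentiableAt (by simp)
  -- The hypothesis gives `a` separately at each point, without regularity. A fixed linear `π` that
  -- recovers the `𝔞`-part makes it a smooth form.
  obtain ⟨π, hπ⟩ : ∃ π : 𝔤 →ₗ[ℝ] 𝔞, ∀ (a : 𝔞) (z : 𝔤), z ∈ 𝔤₀ → π (a + z) = a := by
    obtain ⟨r, hr⟩ := 𝔞.subtype.exists_leftInverse_of_injective 𝔞.ker_subtype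
    refine ⟨r ∘ₗ 𝔤₁.subtype ∘ₗ Submodule.projectionOnto 𝔤₁ 𝔤₀ hd.isCompl.symm,
      fun a z hz => ?_⟩
    have h1 : Submodule.projectionOnto 𝔤₁ 𝔤₀ hd.isCompl.symm (a : 𝔤) = ⟨a, ha.prop.1 a.2⟩ :=
      Submodule.projectionOnto_apply_left hd.isCompl.symm ⟨a, ha.prop.1 a.2⟩
    have h2 : Submodule.projectionOnto 𝔤₁ 𝔤₀ hd.isCompl.symm z = 0 :=
      (Submodule.projectionOnto_apply_eq_zero_iff _).2 hz
    simp only [LinearMap.comp_apply, map_add, h1, h2]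
    simpa using DFunLike.congr_fun hr a
  set α : V → V →L[ℝ] 𝔞 := fun y =>
    ((LinearMap.toContinuousLinearMap π).comp (tangentOneCLM ι)).comp (logDerivative E g y) with hα
  have hαs : ContDiffOn ℝ ∞ α U := contDiffOn_const.clm_comp (contDiffOn_logDerivative hU hg)
  have hαθ : ∀ y ∈ U, Function.Injective (α y) ∧
      ∀ v : V, maurerCartan ι (g y) (mfderiv 𝓘(ℝ, V) 𝓘(ℝ, E) g y v) =
        (α y v : 𝔤) + ⁅(α y v : 𝔤), (F y : 𝔤)⁆ := by
    intro y hy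
    obtain ⟨a, hai, hav⟩ := hθ y hy
    have heq : ∀ v, α y v = a v := fun v => by
      have : α y v = π (tangentOneCLM ι (logDerivative E g y v)) := rfl
      rw [this, (maurerCartan_mfderiv ι (hgd y hy) v).symm.trans (hav v),
        hπ _ _ (hd.lie_mem_zero ha _ _)]
    exact ⟨fun v w hvw => hai (by rw [← heq, ← heq, hvw]), fun v => by rw [heq]; exact hav v⟩
  -- Convexity of the ball is what the Poincaré lemma needs.
  obtain ⟨r, hr, hrU⟩ := Metric.isOpen_iff.1 hU x₀ hx₀
  set B := Metric.ball x₀ r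
  have hBo : IsOpen B := Metric.isOpen_ball
  obtain ⟨f, hf⟩ := (convex_ball x₀ r).exists_forall_hasFDerivAt_of_fderiv_symmetric hBo
    ((hαs.differentiableOn (by simp)).mono hrU) (fun y hy v w =>
      (structure_of_maurerCartan_eq ι hd ha hU hg (hF.differentiableOn (by simp))
        (hαs.differentiableOn (by simp)) (fun z hz => (hαθ z hz).2) (hrU hy) v w).1)
  have hfs : ContDiffOn ℝ ∞ f B := by
    rw [contDiffOn_infty_iff_fderiv_of_isOpen hBo]
    exact ⟨fun y hy => (hf y hy).differentiableAt.differentiableWithinAt,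
      (hαs.mono hrU).congr fun y hy => (hf y hy).fderiv⟩
  have hequiv : ∀ y ∈ U, ∃ L : V ≃L[ℝ] 𝔞, (L : V →L[ℝ] 𝔞) = α y := fun y hy =>
    ⟨(LinearMap.linearEquivOfInjective (α y : V →ₗ[ℝ] 𝔞)
      (hαθ y hy).1 hdim).toContinuousLinearEquiv, by ext; rfl⟩
  have hxB : x₀ ∈ B := Metric.mem_ball_self hr
  obtain ⟨L₀, hL₀⟩ := hequiv x₀ hx₀
  have hfx : ContDiffAt ℝ ∞ f x₀ := hfs.contDiffAt (hBo.mem_nhds hxB)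
  set h₀ := hfx.toOpenPartialHomeomorph f (f' := L₀) (hL₀ ▸ hf x₀ hxB) (by simp)
  -- Inside `B` the derivative of `f` is the invertible `α` everywhere, so the inverse is smooth on
  -- the whole target.
  set h := h₀.restrOpen B hBo
  have hsource : h.source ⊆ B := Set.inter_subset_right
  have hxs : x₀ ∈ h.source :=
    ⟨hfx.mem_toOpenPartialHomeomorph_source (hL₀ ▸ hf x₀ hxB) (by simp), hxB⟩
  have hinv : ∀ z ∈ h.target, ContDiffAt ℝ ∞ h.symm z := fun z hz => by
    have hzB := hsource (h.map_target hz)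
    obtain ⟨L, hL⟩ := hequiv _ (hrU hzB)
    exact h.contDiffAt_symm (f₀' := L) hz (hL ▸ hf _ hzB) (hfs.contDiffAt (hBo.mem_nhds hzB))
  refine ⟨h.symm, hxs, hsource.trans hrU, fun z hz => (hinv z hz).contDiffWithinAt,
    hfs.mono hsource, ?_, ?_⟩
  · exact hg.comp (contMDiffOn_iff_contDiffOn.2 fun z hz => (hinv z hz).contDiffWithinAt)
      fun z hz => hrU (hsource (h.map_target hz))
  · intro z hz v
    have hzB := hsource (h.map_target hz)
    have hd1 : DifferentiableAt ℝ h.symm z := (hinv z hz).differentiableAt (by simp)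
    have e1 : maurerCartan ι ((g ∘ h.symm) z)
        (mfderiv 𝓘(ℝ, 𝔞) 𝓘(ℝ, E) (g ∘ h.symm) z v) =
        maurerCartan ι (g (h.symm z)) (mfderiv 𝓘(ℝ, V) 𝓘(ℝ, E) g (h.symm z)
          (fderiv ℝ h.symm z v)) := by
      rw [mfderiv_comp (I' := 𝓘(ℝ, V)) z (hgd _ (hrU hzB)) hd1.mdifferentiableAt,
        mfderiv_eq_fderiv]
      rfl
    -- Differentiate `f ∘ h.symm = id`, using `df = α`.
    have e2 : α (h.symm z) (fderiv ℝ h.symm z v) = v := by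
      have h1 : HasFDerivAt (f ∘ h.symm) ((α (h.symm z)).comp (fderiv ℝ h.symm z)) z :=
        (hf _ hzB).comp z hd1.hasFDerivAt
      have h2 : HasFDerivAt (f ∘ h.symm) (ContinuousLinearMap.id ℝ 𝔞) z :=
        (hasFDerivAt_id z).congr_of_eventuallyEq
          (Filter.eventually_of_mem (h.open_target.mem_nhds hz) fun y hy => h.right_inv hy)
      exact DFunLike.congr_fun (h1.unique h2) v
    have e3 := (hαθ _ (hrU hzB)).2 (fderiv ℝ h.symm z v)
    rw [e2] at e3
    exact e1.trans e3

end Primitives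

/-! ### Linear algebra of adapted bases. -/

section Tableau

variable {𝔤 : Type*} [LieRing 𝔤] [LieAlgebra ℝ 𝔤] {𝔤₀ 𝔤₁ 𝔞 𝔟 : Submodule ℝ 𝔤}

/-- The part of an adapted basis that spans `𝔞`. -/
noncomputable def AdaptedBasis.vecA {P : Type*} [AddCommGroup P] [Module ℝ P]
    {Q : P →ₗ[ℝ] 𝔞 →ₗ[ℝ] 𝔟} {k h s : ℕ} (e : AdaptedBasis Q k h s) (i : Fin k) : 𝔞 :=
  ⟨e.basis (Sum.inl i), e.span_A.le (Submodule.subset_span ⟨i, rfl⟩)⟩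

section

variable {P : Type*} [AddCommGroup P] [Module ℝ P] {Q : P →ₗ[ℝ] 𝔞 →ₗ[ℝ] 𝔟} {k h s : ℕ}
  (e : AdaptedBasis Q k h s)

theorem AdaptedBasis.coord_inr_of_mem {a : 𝔤} (ha : a ∈ 𝔞) (m : Fin h ⊕ Fin s) :
    e.basis.coord (Sum.inr m) a = 0 := by
  have hle : 𝔞 ≤ LinearMap.ker (e.basis.coord (Sum.inr m)) := by
    refine e.span_A.ge.trans (Submodule.span_le.2 ?_)
    rintro _ ⟨i, rfl⟩
    simp
  exact hle ha

/-- The index `m` covers the `A`- and `C`-coordinates together; both vanish on the span of the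
`B_j`, which contains every image of the tableau. -/
theorem AdaptedBasis.coord_of_mem_range (p : P) (a : 𝔞) (m : Fin k ⊕ Fin s) :
    e.basis.coord (Sum.elim Sum.inl (Sum.inr ∘ Sum.inr) m) (Q p a : 𝔤) = 0 := by
  have hle : (⨆ p : P, LinearMap.range (𝔟.subtype ∘ₗ Q p)) ≤
      LinearMap.ker (e.basis.coord (Sum.elim Sum.inl (Sum.inr ∘ Sum.inr) m)) := by
    rw [← e.span_B, Submodule.span_le]
    rintro _ ⟨j, rfl⟩
    cases m <;> simp
  exact hle (Submodule.mem_iSup_of_mem p ⟨a, rfl⟩)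

theorem AdaptedBasis.eq_sum_coord (a : 𝔞) :
    a = ∑ i, e.basis.coord (Sum.inl i) (a : 𝔤) • e.vecA i := by
  refine Subtype.ext (e.basis.ext_elem fun m => ?_)
  rw [← e.basis.coord_apply, ← e.basis.coord_apply]
  rcases m with i | m
  · simp [AdaptedBasis.vecA, Finsupp.single_apply]
  · rw [e.coord_inr_of_mem a.2, e.coord_inr_of_mem (Subtype.prop _)]

theorem AdaptedBasis.ext_coord {a b : 𝔞}
    (hab : ∀ i, e.basis.coord (Sum.inl i) (a : 𝔤) = e.basis.coord (Sum.inl i) (b : 𝔤)) :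
    a = b := by
  rw [e.eq_sum_coord a, e.eq_sum_coord b]
  simp only [hab]

end

theorem cartanTableau_apply_coe (hd : IsCartanDecomposition 𝔤₀ 𝔤₁) (ha : IsMaximalAbelianIn 𝔤₁ 𝔞)
    (p : cartanM 𝔤₁ 𝔞) (a : 𝔞) : (cartanTableau hd ha p a : 𝔤) = ⁅(a : 𝔤), (p : 𝔤)⁆ :=
  lie_skew _ _

variable {hd : IsCartanDecomposition 𝔤₀ 𝔤₁} {ha : IsMaximalAbelianIn 𝔤₁ 𝔞} {k h s : ℕ}
  (e : AdaptedBasis (cartanTableau hd ha) k h s)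

theorem AdaptedBasis.coord_inl_add_lie (a : 𝔞) (p : cartanM 𝔤₁ 𝔞) (i : Fin k) :
    e.basis.coord (Sum.inl i) ((a : 𝔤) + ⁅(a : 𝔤), (p : 𝔤)⁆) =
      e.basis.coord (Sum.inl i) (a : 𝔤) := by
  rw [map_add, ← cartanTableau_apply_coe hd ha p a]
  simpa using e.coord_of_mem_range p a (Sum.inl i)

/-- The equations `β^j = Q^j_i(p) α^i`, `γ^l = 0` at an element of `𝔤` say that it is of the form
`a + [a, p]` with `a ∈ 𝔞`, where `a` is given by the `α^i`. -/
theorem AdaptedBasis.coord_eq_iff (t : 𝔤) (p : cartanM 𝔤₁ 𝔞) :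
    ((∀ j, e.basis.coord (Sum.inr (Sum.inl j)) t =
        ∑ i, e.basis.coord (Sum.inr (Sum.inl j)) (cartanTableau hd ha p (e.vecA i) : 𝔤) *
          e.basis.coord (Sum.inl i) t) ∧
      ∀ l, e.basis.coord (Sum.inr (Sum.inr l)) t = 0) ↔
    t = ((∑ i, e.basis.coord (Sum.inl i) t • e.vecA i : 𝔞) : 𝔤) +
      ⁅((∑ i, e.basis.coord (Sum.inl i) t • e.vecA i : 𝔞) : 𝔤), (p : 𝔤)⁆ := by
  set a : 𝔞 := ∑ i, e.basis.coord (Sum.inl i) t • e.vecA i with hadef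
  have hcA : ∀ i, e.basis.coord (Sum.inl i) (a : 𝔤) = e.basis.coord (Sum.inl i) t := fun i => by
    simp [hadef, AdaptedBasis.vecA, Finsupp.single_apply]
  have hcB : ∀ j, e.basis.coord (Sum.inr (Sum.inl j)) (⁅(a : 𝔤), (p : 𝔤)⁆) =
      ∑ i, e.basis.coord (Sum.inr (Sum.inl j)) (cartanTableau hd ha p (e.vecA i) : 𝔤) *
          e.basis.coord (Sum.inl i) t := fun j => by
    rw [← cartanTableau_apply_coe hd ha p a, hadef, map_sum]
    simp [-Module.Basis.coord_apply, mul_comm]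
  have hcC : ∀ l, e.basis.coord (Sum.inr (Sum.inr l)) (⁅(a : 𝔤), (p : 𝔤)⁆) = 0 := fun l => by
    rw [← cartanTableau_apply_coe hd ha p a]
    simpa using e.coord_of_mem_range p a (Sum.inr l)
  constructor
  · rintro ⟨hB, hC⟩
    refine e.basis.ext_elem fun m => ?_
    rw [← e.basis.coord_apply, ← e.basis.coord_apply]
    rcases m with i | j | l
    · rw [e.coord_inl_add_lie, hcA]
    · rw [map_add, e.coord_inr_of_mem a.2, hcB, hB, zero_add]
    · rw [map_add, e.coord_inr_of_mem a.2, hcC, hC, zero_add]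
  · intro ht
    refine ⟨fun j => ?_, fun l => ?_⟩
    · conv_lhs => rw [ht]
      rw [map_add, e.coord_inr_of_mem a.2, hcB, zero_add]
    · rw [ht, map_add, e.coord_inr_of_mem a.2, hcC, zero_add]

end Tableau

/-! ### Derivatives on open subsets of a vector space. -/

section Opens

variable {V : Type*} [NormedAddCommGroup V] [NormedSpace ℝ V]
  {E : Type*} [NormedAddCommGroup E] [NormedSpace ℝ E] {H : Type*} [TopologicalSpace H]
  {I : ModelWithCorners ℝ E H} {M : Type*} [TopologicalSpace M] [ChartedSpace H M]

theorem hasMFDerivAt_opens_subtype_val (U : TopologicalSpace.Opens V) (x : U) :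
    HasMFDerivAt 𝓘(ℝ, V) 𝓘(ℝ, V) (Subtype.val : U → V) x (ContinuousLinearMap.id ℝ V) := by
  refine ⟨continuous_subtype_val.continuousAt, ?_⟩
  have key : writtenInExtChartAt 𝓘(ℝ, V) 𝓘(ℝ, V) x (Subtype.val : U → V) =ᶠ[𝓝 (x : V)] id :=
    (TopologicalSpace.Opens.chartAt_subtype_val_symm_eventuallyEq (H := V) U (x := x)).symm
  have hpt : extChartAt 𝓘(ℝ, V) x x = (x : V) := rfl
  rw [hpt]
  exact ((hasFDerivAt_id (x : V)).congr_of_eventuallyEq key).hasFDerivWithinAt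

/-- Links `IsIntegralManifold`, stated on the manifold `U`, with `IsPrimitive`, stated for maps on
all of `𝔞`. -/
theorem mfderiv_comp_opens_subtype_val {U : TopologicalSpace.Opens V} {f : V → M} {x : U}
    (hf : MDifferentiableAt 𝓘(ℝ, V) I f x) (v : V) :
    mfderiv 𝓘(ℝ, V) I (fun y : U => f y) x v = mfderiv 𝓘(ℝ, V) I f x v :=
  DFunLike.congr_fun (hf.hasMFDerivAt.comp x (hasMFDerivAt_opens_subtype_val U x)).mfderiv v

end Opens

/-! ### Integral manifolds and the Maurer–Cartan form. -/

section IntegralManifolds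

variable {𝔤 : Type*} [NormedLieRing 𝔤] [NormedLieAlgebra 𝔤]
  {E : Type*} [NormedAddCommGroup E] [NormedSpace ℝ E] [CompleteSpace E]
  {G : Type*} [TopologicalSpace G] [ChartedSpace E G] [Group G] [LieGroup 𝓘(ℝ, E) ∞ G]
  (ι : 𝔤 ≃ₗ⁅ℝ⁆ GroupLieAlgebra 𝓘(ℝ, E) G)
  {E' : Type*} [NormedAddCommGroup E'] [NormedSpace ℝ E']
  {N : Type*} [TopologicalSpace N] [ChartedSpace E' N]

/-- The pullback of the Maurer--Cartan form by a map into the group. -/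
noncomputable def pullbackMaurerCartan (g : N → G) (q : N) : TangentSpace 𝓘(ℝ, E') q →ₗ[ℝ] 𝔤 :=
  maurerCartan ι (g q) ∘ₗ (mfderiv 𝓘(ℝ, E') 𝓘(ℝ, E) g q).toLinearMap

/-- Reduces all the scalar forms to coordinates of one `𝔤`-valued form. -/
theorem pullback_coframeForm_apply {n P : Type*} [NormedAddCommGroup P] [NormedSpace ℝ P]
    (b : Module.Basis n ℝ 𝔤) (i : n) {Φ : N → G × P} {q : N}
    (hΦ : MDifferentiableAt 𝓘(ℝ, E') (𝓘(ℝ, E).prod 𝓘(ℝ, P)) Φ q) (v : TangentSpace 𝓘(ℝ, E') q) :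
    OneForm.pullback 𝓘(ℝ, E') (𝓘(ℝ, E).prod 𝓘(ℝ, P)) Φ (coframeForm P ι b i) q v =
      b.coord i (pullbackMaurerCartan ι (fun q => (Φ q).1) q v) := by
  have h := mfderiv_comp (I' := 𝓘(ℝ, E).prod 𝓘(ℝ, P)) q
    (mdifferentiableAt_fst (I := 𝓘(ℝ, E)) (I' := 𝓘(ℝ, P)) (x := Φ q)) hΦ
  have h2 : mfderiv 𝓘(ℝ, E') 𝓘(ℝ, E) (fun q => (Φ q).1) q v =
      mfderiv (𝓘(ℝ, E).prod 𝓘(ℝ, P)) 𝓘(ℝ, E) Prod.fst (Φ q)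
        (mfderiv 𝓘(ℝ, E') (𝓘(ℝ, E).prod 𝓘(ℝ, P)) Φ q v) := DFunLike.congr_fun h v
  change _ = b.coord i (maurerCartan ι (Φ q).1 (mfderiv 𝓘(ℝ, E') 𝓘(ℝ, E) (fun q => (Φ q).1) q v))
  rw [h2]
  rfl

variable {𝔤₀ 𝔤₁ 𝔞 : Submodule ℝ 𝔤} {hd : IsCartanDecomposition 𝔤₀ 𝔤₁}
  {ha : IsMaximalAbelianIn 𝔤₁ 𝔞} {k h s : ℕ} (e : AdaptedBasis (cartanTableau hd ha) k h s)

/-- The projection to `𝔞` along the other members of an adapted basis. -/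
noncomputable def AdaptedBasis.projA : 𝔤 →ₗ[ℝ] 𝔞 :=
  ∑ i, (e.basis.coord (Sum.inl i)).smulRight (e.vecA i)

theorem AdaptedBasis.projA_apply (t : 𝔤) :
    e.projA t = ∑ i, e.basis.coord (Sum.inl i) t • e.vecA i := by
  simp [AdaptedBasis.projA]

theorem AdaptedBasis.projA_add_lie (a : 𝔞) (p : cartanM 𝔤₁ 𝔞) :
    e.projA ((a : 𝔤) + ⁅(a : 𝔤), (p : 𝔤)⁆) = a := by
  rw [e.projA_apply]
  simp only [e.coord_inl_add_lie]
  exact (e.eq_sum_coord a).symm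

theorem AdaptedBasis.coord_projA (t : 𝔤) (i : Fin k) :
    e.basis.coord (Sum.inl i) (e.projA t : 𝔤) = e.basis.coord (Sum.inl i) t := by
  simp [e.projA_apply, AdaptedBasis.vecA, Finsupp.single_apply]

/-- The generators of the associated system vanish along `Φ = (g, F)` exactly if the pullback of
the Maurer--Cartan form is of the form `α + [α, F]`. -/
theorem pullback_gens_eq_zero_iff {Φ : N → G × cartanM 𝔤₁ 𝔞} {q : N}
    (hΦ : MDifferentiableAt 𝓘(ℝ, E') (𝓘(ℝ, E).prod 𝓘(ℝ, cartanM 𝔤₁ 𝔞)) Φ q) :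
    (∀ θ ∈ (associatedSystem ι e).gens,
      OneForm.pullback 𝓘(ℝ, E') (𝓘(ℝ, E).prod 𝓘(ℝ, cartanM 𝔤₁ 𝔞)) Φ θ q = 0) ↔
    ∀ v : TangentSpace 𝓘(ℝ, E') q, pullbackMaurerCartan ι (fun q => (Φ q).1) q v =
      (e.projA (pullbackMaurerCartan ι (fun q => (Φ q).1) q v) : 𝔤) +
        ⁅(e.projA (pullbackMaurerCartan ι (fun q => (Φ q).1) q v) : 𝔤), ((Φ q).2 : 𝔤)⁆ := by
  have hB : ∀ j v, OneForm.pullback 𝓘(ℝ, E') (𝓘(ℝ, E).prod 𝓘(ℝ, cartanM 𝔤₁ 𝔞)) Φ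
      (fun y : G × cartanM 𝔤₁ 𝔞 => coframeForm (cartanM 𝔤₁ 𝔞) ι e.basis (Sum.inr (Sum.inl j)) y -
        ∑ i : Fin k, e.basis.coord (Sum.inr (Sum.inl j)) (cartanTableau hd ha y.2 (e.vecA i) : 𝔤) •
            coframeForm (cartanM 𝔤₁ 𝔞) ι e.basis (Sum.inl i) y) q v =
      e.basis.coord (Sum.inr (Sum.inl j)) (pullbackMaurerCartan ι (fun q => (Φ q).1) q v) -
        ∑ i, e.basis.coord (Sum.inr (Sum.inl j))
          (cartanTableau hd ha (Φ q).2 (e.vecA i) : 𝔤) *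
            e.basis.coord (Sum.inl i) (pullbackMaurerCartan ι (fun q => (Φ q).1) q v) := by
    intro j v
    simp only [← pullback_coframeForm_apply ι e.basis _ hΦ]
    simp only [OneForm.pullback, LinearMap.comp_apply, LinearMap.sub_apply, LinearMap.sum_apply,
      LinearMap.smul_apply, smul_eq_mul]
  simp only [e.projA_apply, ← e.coord_eq_iff]
  constructor
  · intro hθ v
    refine ⟨fun j => ?_, fun l => ?_⟩
    · have h1 := DFunLike.congr_fun (hθ _ (Or.inl ⟨j, rfl⟩)) v
      exact sub_eq_zero.1 ((hB j v).symm.trans h1)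
    · have h1 := DFunLike.congr_fun (hθ _ (Or.inr ⟨l, rfl⟩)) v
      exact (pullback_coframeForm_apply ι e.basis _ hΦ v).symm.trans h1
  · rintro hv θ (⟨j, rfl⟩ | ⟨l, rfl⟩)
    · ext v
      exact (hB j v).trans (sub_eq_zero.2 ((hv v).1 j))
    · ext v
      exact (pullback_coframeForm_apply ι e.basis _ hΦ v).trans ((hv v).2 l)

variable {ι e}

theorem IsIntegralManifold.mdifferentiableAt {Φ : N → G × cartanM 𝔤₁ 𝔞}
    (hΦ : IsIntegralManifold 𝓘(ℝ, E') (associatedSystem ι e) Φ) (q : N) :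
    MDifferentiableAt 𝓘(ℝ, E') (𝓘(ℝ, E).prod 𝓘(ℝ, cartanM 𝔤₁ 𝔞)) Φ q :=
  hΦ.contMDiff.contMDiffAt.mdifferentiableAt (by simp)

theorem IsIntegralManifold.pullbackMaurerCartan_eq {Φ : N → G × cartanM 𝔤₁ 𝔞}
    (hΦ : IsIntegralManifold 𝓘(ℝ, E') (associatedSystem ι e) Φ) (q : N)
    (v : TangentSpace 𝓘(ℝ, E') q) :
    pullbackMaurerCartan ι (fun q => (Φ q).1) q v =
      (e.projA (pullbackMaurerCartan ι (fun q => (Φ q).1) q v) : 𝔤) +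
        ⁅(e.projA (pullbackMaurerCartan ι (fun q => (Φ q).1) q v) : 𝔤), ((Φ q).2 : 𝔤)⁆ :=
  (pullback_gens_eq_zero_iff ι e (hΦ.mdifferentiableAt q)).1
    (fun θ hθ => hΦ.pullback_eq_zero θ hθ q) v

/-- The independence condition makes the `𝔞`-part of the Maurer--Cartan form a coframe. -/
theorem IsIntegralManifold.injective_projA [FiniteDimensional ℝ E'] {Φ : N → G × cartanM 𝔤₁ 𝔞}
    (hΦ : IsIntegralManifold 𝓘(ℝ, E') (associatedSystem ι e) Φ) (q : N) :
    Function.Injective (e.projA ∘ₗ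
      (pullbackMaurerCartan ι (fun q => (Φ q).1) q : TangentSpace 𝓘(ℝ, E') q →ₗ[ℝ] 𝔤)) := by
  set T : E' →ₗ[ℝ] 𝔤 := pullbackMaurerCartan ι (fun q => (Φ q).1) q with hT
  -- `L` collects the `α^i`. The nonzero determinant makes it surjective, and `dim N = k` then makes
  -- it injective.
  let L : E' →ₗ[ℝ] Fin k → ℝ := LinearMap.pi fun i => e.basis.coord (Sum.inl i) ∘ₗ T
  obtain ⟨v, hv⟩ := hΦ.indep_ne_zero q
  have hmat : (Matrix.of fun i j => OneForm.pullback 𝓘(ℝ, E')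
      (𝓘(ℝ, E).prod 𝓘(ℝ, cartanM 𝔤₁ 𝔞)) Φ ((associatedSystem ι e).indep i) q (v j)) =
      Matrix.of fun i j => L (v j) i := by
    ext i j
    exact pullback_coframeForm_apply ι e.basis _ (hΦ.mdifferentiableAt q) (v j)
  rw [hmat] at hv
  have hli : LinearIndependent ℝ fun j => L (v j) := Matrix.linearIndependent_cols_of_det_ne_zero hv
  have hspan := hli.span_eq_top_of_card_eq_finrank' (by simp)
  have hsurj : Function.Surjective L := by
    rw [← LinearMap.range_eq_top, eq_top_iff, ← hspan, Submodule.span_le]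
    rintro _ ⟨j, rfl⟩
    exact ⟨v j, rfl⟩
  have hinj : Function.Injective L :=
    (LinearMap.injective_iff_surjective_of_finrank_eq_finrank
      (by rw [hΦ.finrank_eq]; simp)).2 hsurj
  intro x y hxy
  refine hinj (funext fun i => ?_)
  have hx : e.basis.coord (Sum.inl i) (e.projA (T x) : 𝔤) =
    e.basis.coord (Sum.inl i) (e.projA (T y) : 𝔤) :=
    congrArg (fun a : 𝔞 => e.basis.coord (Sum.inl i) (a : 𝔤)) hxy
  rw [e.coord_projA, e.coord_projA] at hx
  exact hx

/-- A primitive of `α + [α, F]` and `F` form an integral manifold. -/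
theorem isIntegralManifold_of_isPrimitive (A : Module.Basis (Fin k) ℝ 𝔞)
    (U : TopologicalSpace.Opens 𝔞) {F : 𝔞 → cartanM 𝔤₁ 𝔞} {g : 𝔞 → G}
    (hF : ContDiffOn ℝ ∞ F U) (hg : IsPrimitive ι (U : Set 𝔞) F g) :
    IsIntegralManifold 𝓘(ℝ, 𝔞) (associatedSystem ι e) (fun x : U => (g x, F x)) := by
  have hgx : ∀ x : U, ContMDiffAt 𝓘(ℝ, 𝔞) 𝓘(ℝ, E) ∞ g x := fun x =>
    hg.1.contMDiffAt (U.isOpen.mem_nhds x.2)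
  have hFx : ∀ x : U, ContMDiffAt 𝓘(ℝ, 𝔞) 𝓘(ℝ, cartanM 𝔤₁ 𝔞) ∞ F x := fun x =>
    (hF.contDiffAt (U.isOpen.mem_nhds x.2)).contMDiffAt
  have hΦ : ContMDiff 𝓘(ℝ, 𝔞) (𝓘(ℝ, E).prod 𝓘(ℝ, cartanM 𝔤₁ 𝔞)) ∞
      (fun x : U => (g x, F x)) := fun x =>
    (contMDiffAt_subtype_iff.2 (hgx x)).prodMk (contMDiffAt_subtype_iff.2 (hFx x))
  have hΦd : ∀ x, MDifferentiableAt 𝓘(ℝ, 𝔞) (𝓘(ℝ, E).prod 𝓘(ℝ, cartanM 𝔤₁ 𝔞))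
      (fun x : U => (g x, F x)) x := fun x => hΦ.contMDiffAt.mdifferentiableAt (by simp)
  have hT : ∀ (x : U) (v : 𝔞), pullbackMaurerCartan ι (fun x : U => g x) x v =
      (v : 𝔤) + ⁅(v : 𝔤), (F x : 𝔤)⁆ := fun x v => by
    refine Eq.trans ?_ (hg.2 x x.2 v)
    exact congrArg (maurerCartan ι (g x))
      (mfderiv_comp_opens_subtype_val ((hgx x).mdifferentiableAt (by simp)) v)
  refine ⟨by simp [Module.finrank_eq_card_basis A], hΦ, fun x v w hvw => ?_, fun θ hθ x => ?_,
    fun x => ⟨fun j => e.vecA j, ?_⟩⟩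
  -- The numbers `α^i(dΦ(u))` are the coordinates of `u`, so `dΦ(u)` determines `u`.
  · have hcoord : ∀ u : 𝔞, ∀ i, e.basis.coord (Sum.inl i) (u : 𝔤) =
        OneForm.pullback 𝓘(ℝ, 𝔞) (𝓘(ℝ, E).prod 𝓘(ℝ, cartanM 𝔤₁ 𝔞)) (fun x : U => (g x, F x))
          (coframeForm (cartanM 𝔤₁ 𝔞) ι e.basis (Sum.inl i)) x u := fun u i => by
      refine Eq.trans ?_ (pullback_coframeForm_apply ι e.basis _ (hΦd x) u).symm
      refine Eq.trans ?_ (congrArg _ (hT x u).symm)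
      rw [e.coord_inl_add_lie]
    refine e.ext_coord (a := v) (b := w) fun i => ?_
    refine (hcoord v i).trans (Eq.trans ?_ (hcoord w i).symm)
    exact congrArg (coframeForm (cartanM 𝔤₁ 𝔞) ι e.basis (Sum.inl i) (g x, F x)) hvw
  · refine (pullback_gens_eq_zero_iff ι e (hΦd x)).2 (fun v => ?_) θ hθ
    have hv := hT x v
    simp only [hv]
    exact congrArg (fun a : 𝔞 => (a : 𝔤) + ⁅(a : 𝔤), (F x : 𝔤)⁆) (e.projA_add_lie v (F x)).symm
  -- On the test vectors `A_j`, `α^i` takes the values of the identity matrix.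
  · have hone : (Matrix.of fun i j => OneForm.pullback 𝓘(ℝ, 𝔞)
        (𝓘(ℝ, E).prod 𝓘(ℝ, cartanM 𝔤₁ 𝔞)) (fun x : U => (g x, F x))
        ((associatedSystem ι e).indep i) x (e.vecA j)) = (1 : Matrix (Fin k) (Fin k) ℝ) := by
      ext i j
      refine (pullback_coframeForm_apply ι e.basis _ (hΦd x) (e.vecA j)).trans ?_
      refine (congrArg _ (hT x (e.vecA j))).trans ?_
      rw [e.coord_inl_add_lie]
      simp [AdaptedBasis.vecA, Finsupp.single_apply, Matrix.one_apply, eq_comm]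
    rw [hone]
    simp

/-- An integral manifold on which the `α^i` are the coordinate differentials is a primitive of
`α + [α, F]`. -/
theorem IsIntegralManifold.isPrimitive_of_coord_eq {U : TopologicalSpace.Opens 𝔞}
    {F : 𝔞 → cartanM 𝔤₁ 𝔞} {g : 𝔞 → G}
    (hΦ : IsIntegralManifold 𝓘(ℝ, 𝔞) (associatedSystem ι e) (fun x : U => (g x, F x)))
    (hcoord : ∀ (i : Fin k) (x : U) (v : 𝔞),
      OneForm.pullback 𝓘(ℝ, 𝔞) (𝓘(ℝ, E).prod 𝓘(ℝ, cartanM 𝔤₁ 𝔞)) (fun x : U => (g x, F x))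
        ((associatedSystem ι e).indep i) x v = e.basis.coord (Sum.inl i) (v : 𝔤)) :
    ContDiffOn ℝ ∞ F U ∧ IsPrimitive ι (U : Set 𝔞) F g := by
  have hgx : ∀ x : U, ContMDiffAt 𝓘(ℝ, 𝔞) 𝓘(ℝ, E) ∞ g x := fun x =>
    contMDiffAt_subtype_iff.1 (hΦ.contMDiff.fst x)
  have hFx : ∀ x : U, ContMDiffAt 𝓘(ℝ, 𝔞) 𝓘(ℝ, cartanM 𝔤₁ 𝔞) ∞ F x := fun x =>
    contMDiffAt_subtype_iff.1 (hΦ.contMDiff.snd x)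
  refine ⟨fun x hx => (hFx ⟨x, hx⟩).contDiffAt.contDiffWithinAt,
    fun x hx => (hgx ⟨x, hx⟩).contMDiffWithinAt, fun x hx v => ?_⟩
  have h1 := hΦ.pullbackMaurerCartan_eq ⟨x, hx⟩ v
  have h2 : e.projA (pullbackMaurerCartan ι (fun y : U => g y) ⟨x, hx⟩ v) = v := by
    refine e.ext_coord fun i => ?_
    rw [e.coord_projA]
    exact (pullback_coframeForm_apply ι e.basis _ (hΦ.mdifferentiableAt ⟨x, hx⟩) v).symm.trans
      (hcoord i ⟨x, hx⟩ v)
  have h3 : pullbackMaurerCartan ι (fun y : U => g y) ⟨x, hx⟩ v =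
      maurerCartan ι (g x) (mfderiv 𝓘(ℝ, 𝔞) 𝓘(ℝ, E) g x v) :=
    congrArg (maurerCartan ι (g x)) (mfderiv_comp_opens_subtype_val (x := (⟨x, hx⟩ : U))
      ((hgx ⟨x, hx⟩).mdifferentiableAt (by simp)) v)
  simp only [h2] at h1
  exact h3.symm.trans h1

/-- An integral manifold is locally parametrized by a solution of the system and a primitive. -/
theorem IsIntegralManifold.exists_coordinates [FiniteDimensional ℝ 𝔤]
    [FiniteDimensional ℝ E] [FiniteDimensional ℝ E'] [IsManifold 𝓘(ℝ, E') ∞ N]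
    (A : Module.Basis (Fin k) ℝ 𝔞) {Φ : N → G × cartanM 𝔤₁ 𝔞}
    (hΦ : IsIntegralManifold 𝓘(ℝ, E') (associatedSystem ι e) Φ) (q : N) :
    ∃ (φ : OpenPartialHomeomorph 𝔞 N) (F : 𝔞 → cartanM 𝔤₁ 𝔞) (g : 𝔞 → G),
      q ∈ φ.target ∧ ContMDiffOn 𝓘(ℝ, 𝔞) 𝓘(ℝ, E') ∞ φ φ.source ∧
      ContMDiffOn 𝓘(ℝ, E') 𝓘(ℝ, 𝔞) ∞ φ.symm φ.target ∧
      IsSystemSolution A φ.source F ∧ IsPrimitive ι φ.source F g ∧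
      ∀ x ∈ φ.source, Φ (φ x) = (g x, F x) := by
  have : IsManifold 𝓘(ℝ, E') 1 N :=
    IsManifold.of_le (n := ∞) (WithTop.coe_le_coe.2 (le_top : (1 : ℕ∞) ≤ ⊤))
  set c := chartAt E' q
  have hcs : ContMDiffOn 𝓘(ℝ, E') 𝓘(ℝ, E') ∞ c.symm c.target := contMDiffOn_chart_symm
  have hcs' : ContMDiffOn 𝓘(ℝ, E') 𝓘(ℝ, E') ∞ c c.source := contMDiffOn_chart
  have hg₀ : ContMDiffOn 𝓘(ℝ, E') 𝓘(ℝ, E) ∞ (fun y => (Φ (c.symm y)).1) c.target :=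
    hΦ.contMDiff.fst.comp_contMDiffOn hcs
  have hF₀ : ContDiffOn ℝ ∞ (fun y => (Φ (c.symm y)).2) c.target :=
    contMDiffOn_iff_contDiffOn.1 (hΦ.contMDiff.snd.comp_contMDiffOn hcs)
  have hcd : ∀ y ∈ c.target, MDifferentiableAt 𝓘(ℝ, E') 𝓘(ℝ, E') c.symm y := fun y hy =>
    (hcs.contMDiffAt (c.open_target.mem_nhds hy)).mdifferentiableAt (by simp)
  have hinj : ∀ y ∈ c.target, Function.Injective (mfderiv 𝓘(ℝ, E') 𝓘(ℝ, E') c.symm y) := by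
    intro y hy
    have hcd' : MDifferentiableAt 𝓘(ℝ, E') 𝓘(ℝ, E') c (c.symm y) :=
      (hcs'.contMDiffAt (c.open_source.mem_nhds (c.map_target hy))).mdifferentiableAt (by simp)
    have h1 := hcd'.hasMFDerivAt.comp y (hcd y hy).hasMFDerivAt
    have h2 : HasMFDerivAt 𝓘(ℝ, E') 𝓘(ℝ, E') (c ∘ c.symm) y
        (ContinuousLinearMap.id ℝ (TangentSpace 𝓘(ℝ, E') y)) :=
      (hasMFDerivAt_id y).congr_of_eventuallyEq
        (Filter.eventually_of_mem (c.open_target.mem_nhds hy) fun z hz => c.right_inv hz)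
    have h3 := hasMFDerivAt_unique h1 h2
    exact Function.LeftInverse.injective
      (g := mfderiv 𝓘(ℝ, E') 𝓘(ℝ, E') c (c.symm y)) fun v => DFunLike.congr_fun h3 v
  have hdim : Module.finrank ℝ E' = Module.finrank ℝ 𝔞 := by
    rw [hΦ.finrank_eq, Module.finrank_eq_card_basis A, Fintype.card_fin]
  obtain ⟨χ, hqχ, hχc, hχs, hχs', hχp⟩ := exists_coordinates_of_maurerCartan_eq ι hd ha
    -- In the chart `c`, the coframe is the `𝔞`-part of the Maurer–Cartan form composed with the
    -- injective derivative of `c.symm`.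
    c.open_target hg₀ hF₀ hdim (fun y hy => by
      refine ⟨(e.projA ∘ₗ pullbackMaurerCartan ι (fun q => (Φ q).1) (c.symm y)) ∘ₗ
        (mfderiv 𝓘(ℝ, E') 𝓘(ℝ, E') c.symm y).toLinearMap,
        (hΦ.injective_projA (c.symm y)).comp (hinj y hy), fun v => ?_⟩
      refine Eq.trans ?_ (hΦ.pullbackMaurerCartan_eq (c.symm y)
        (mfderiv 𝓘(ℝ, E') 𝓘(ℝ, E') c.symm y v))
      refine congrArg (maurerCartan ι (Φ (c.symm y)).1) ?_
      exact DFunLike.congr_fun (mfderiv_comp (I' := 𝓘(ℝ, E')) y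
        (hΦ.contMDiff.fst.contMDiffAt.mdifferentiableAt (by simp)) (hcd y hy)) v)
    (mem_chart_target E' q)
  -- The target of `χ` lies in that of `c`, so composing with `c.symm` loses no points.
  have hsub : (χ.trans c.symm).source = χ.source := by
    rw [OpenPartialHomeomorph.trans_source]
    exact Set.inter_eq_left.2 fun x hx => hχc (χ.map_source hx)
  have hFs : ContDiffOn ℝ ∞ ((fun y => (Φ (c.symm y)).2) ∘ χ) χ.source :=
    hF₀.comp hχs fun x hx => hχc (χ.map_source hx)
  refine ⟨χ.trans c.symm, (fun y => (Φ (c.symm y)).2) ∘ χ, (fun y => (Φ (c.symm y)).1) ∘ χ,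
    ?_, ?_, ?_, ?_, ?_, fun x _ => rfl⟩
  · rw [OpenPartialHomeomorph.trans_target]
    exact ⟨mem_chart_source E' q, hqχ⟩
  · rw [hsub]
    exact hcs.comp (contMDiffOn_iff_contDiffOn.2 hχs) fun x hx => hχc (χ.map_source hx)
  · rw [OpenPartialHomeomorph.trans_target]
    exact (contMDiffOn_iff_contDiffOn.2 hχs').comp (hcs'.mono fun x hx => hx.1) fun x hx => hx.2
  · rw [hsub]
    exact hχp.isSystemSolution hd ha A χ.open_source hFs
  · rw [hsub]
    exact hχp

end IntegralManifolds

theorem mainTheorem4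
    {𝔤 : Type*} [NormedLieRing 𝔤] [NormedLieAlgebra 𝔤] [FiniteDimensional ℝ 𝔤]
    [LieAlgebra.IsSemisimple ℝ 𝔤]
    {E : Type*} [NormedAddCommGroup E] [NormedSpace ℝ E] [FiniteDimensional ℝ E] [CompleteSpace E]
    {G : Type*} [TopologicalSpace G] [ChartedSpace E G] [Group G]
    [LieGroup 𝓘(ℝ, E) ∞ G]
    (ι : 𝔤 ≃ₗ⁅ℝ⁆ GroupLieAlgebra 𝓘(ℝ, E) G)
    {𝔤₀ 𝔤₁ 𝔞 : Submodule ℝ 𝔤} (hd : IsCartanDecomposition 𝔤₀ 𝔤₁)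
    (ha : IsMaximalAbelianIn 𝔤₁ 𝔞)
    {k h s : ℕ} (A : Module.Basis (Fin k) ℝ 𝔞)
    (e : AdaptedBasis (cartanTableau hd ha) k h s) :
    -- solutions and their primitives give integral manifolds
    (∀ (U : TopologicalSpace.Opens 𝔞) (F : 𝔞 → cartanM 𝔤₁ 𝔞) (g : 𝔞 → G),
      IsSystemSolution A (U : Set 𝔞) F → IsPrimitive ι (U : Set 𝔞) F g →
      IsIntegralManifold 𝓘(ℝ, 𝔞) (associatedSystem ι e) (fun x : U => (g x, F x))) ∧
    -- every integral manifold is of this form near each of its points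
    (∀ {E' : Type*} [NormedAddCommGroup E'] [NormedSpace ℝ E'] [FiniteDimensional ℝ E']
      {N : Type*} [TopologicalSpace N] [ChartedSpace E' N] [IsManifold 𝓘(ℝ, E') ∞ N]
      (Φ : N → G × cartanM 𝔤₁ 𝔞), IsIntegralManifold 𝓘(ℝ, E') (associatedSystem ι e) Φ →
      ∀ q : N, ∃ (φ : OpenPartialHomeomorph 𝔞 N) (F : 𝔞 → cartanM 𝔤₁ 𝔞) (g : 𝔞 → G),
        q ∈ φ.target ∧
        ContMDiffOn 𝓘(ℝ, 𝔞) 𝓘(ℝ, E') ∞ φ φ.source ∧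
        ContMDiffOn 𝓘(ℝ, E') 𝓘(ℝ, 𝔞) ∞ φ.symm φ.target ∧
        IsSystemSolution A φ.source F ∧ IsPrimitive ι φ.source F g ∧
        ∀ x ∈ φ.source, Φ (φ x) = (g x, F x)) ∧
    -- an integral manifold parametrized by an open set of `𝔞` with `α^i = dx^i` is so globally
    (∀ (U : TopologicalSpace.Opens 𝔞) (F : 𝔞 → cartanM 𝔤₁ 𝔞) (g : 𝔞 → G),
      IsIntegralManifold 𝓘(ℝ, 𝔞) (associatedSystem ι e) (fun x : U => (g x, F x)) →
      (∀ (i : Fin k) (x : U) (v : 𝔞),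
        OneForm.pullback 𝓘(ℝ, 𝔞) (𝓘(ℝ, E).prod 𝓘(ℝ, cartanM 𝔤₁ 𝔞)) (fun x : U => (g x, F x))
          ((associatedSystem ι e).indep i) x v = e.basis.coord (Sum.inl i) (v : 𝔤)) →
      IsSystemSolution A (U : Set 𝔞) F ∧ IsPrimitive ι (U : Set 𝔞) F g) := by
  refine ⟨fun U F g hF hg => isIntegralManifold_of_isPrimitive A U hF.1 hg,
    fun Φ hΦ q => hΦ.exists_coordinates A q, fun U F g hΦ hcoord => ?_⟩
  obtain ⟨hF, hg⟩ := hΦ.isPrimitive_of_coord_eq hcoord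
  exact ⟨hg.isSystemSolution hd ha A U.isOpen hF, hg⟩
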